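/- Let $\mathbb{R}^{3,1}$ be $\mathbb{R}^4$ with the metric $\langle\cdot,\cdot\rangle=-dx_1^2+dx_2^2+dx_3^2+dx_4^2$, and let $M$ be an oriented smooth surface, smoothly immersed in $\mathbb{R}^{3,1}$ and timelike, i.e. the induced metric has signature $(1,1)$. Denote by $II$ its second fundamental form, by $\vec H=\frac12\,\mathrm{tr}\,II$ its mean curvature vector and by $R^\perp$ the curvature tensor of its normal connection. The Gauss map of $M$ is $G:M\to\Lambda^2\mathbb{R}^{3,1}$, $G(p)=u_1\wedge u_2$, where $(u_1,u_2)$ is any positively oriented orthonormal basis of $T_pM$ ($u_1$ timelike). Identify $\Lambda^4\mathbb{R}^{3,1}$ with $\mathbb{R}$ by a volume element, and for $u\in T_pM$ set $\delta(u)=dG_p(u)\wedge dG_p(u)\in\mathbb{R}$. A nonzero vector $u\in T_pM$ defines an asymptotic direction at $p$ if $\delta(u)=0$. Let $Z\in\mathbb{R}^{3,1}$ be a constant vector with $\langle Z,Z\rangle=1$ which defines a canonical null direction on $M$: at every point of $M$ the tangent part $Z^\top$ of $Z$ is nonzero and $\langle Z^\top,Z^\top\rangle=0$. Assume that $II(Z^\top,Z^\top)\neq0$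 at every point of $M$, and let $W$ be the lightlike vector field tangent to $M$ ($W\neq0$, $\langle W,W\rangle=0$) with $\langle Z^\top,W\rangle=-1$. Then, at every point $p$ of $M$: 1. $Z^\top_p$ defines an asymptotic direction at $p$; 2. $W_p$ defines an asymptotic direction at $p$ if and only if $M$ is minimal at $p$ (that is, $\vec H_p=0$) or has flat normal bundle at $p$ (that is, $R^\perp_p=0$). -/

import Mathlib

open scoped Manifold ContDiff Topology

namespace NullDir

/-! ### Minkowski space, bivectors -/

/-- The vector space underlying four-dimensional Minkowski space. -/
abbrev V4 : Type := Fin 4 → ℝ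

/-- The Minkowski product, the first coordinate being the timelike one. -/
def mink (x y : V4) : ℝ := -(x 0 * y 0) + x 1 * y 1 + x 2 * y 2 + x 3 * y 3

/-- The space of bivectors of Minkowski space, as skew-symmetric contravariant tensors of degree two
(a normed space, so that maps with values in it can be differentiated). -/
abbrev Bivector : Submodule ℝ (Fin 4 → Fin 4 → ℝ) where
  carrier := {T | ∀ i j, T j i = -T i j}
  add_mem' := by
    intro a b ha hb i j
    simp only [Pi.add_apply, ha i j, hb i j]
    ring
  zero_mem' := by
    intro i j
    simp
  smul_mem' := by
    intro c a ha i j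
    simp only [Pi.smul_apply, smul_eq_mul, ha i j]
    ring

/-- The simple bivector `x ∧ y`. -/
def wedge (x y : V4) : Bivector :=
  ⟨fun i j => x i * y j - x j * y i, by intro i j; ring⟩

/-- The exterior product of two bivectors, as a real number: the space of vectors of degree four is
identified with the real line by means of the volume element given by the canonical basis. -/
def wedgeWedge (S T : Bivector) : ℝ :=
  S.1 0 1 * T.1 2 3 - S.1 0 2 * T.1 1 3 + S.1 0 3 * T.1 1 2
    + S.1 1 2 * T.1 0 3 - S.1 1 3 * T.1 0 2 + S.1 2 3 * T.1 0 1

/-- `(x ∧ y) ∧ (z ∧ w)` is the determinant of `x, y, z, w`. -/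
theorem wedgeWedge_wedge (x y z w : V4) :
    wedgeWedge (wedge x y) (wedge z w) = Matrix.det (Matrix.of ![x, y, z, w]) := by
  simp [wedgeWedge, wedge, Matrix.det_succ_row_zero, Fin.sum_univ_succ, Fin.succAbove]
  ring

noncomputable section

variable {M : Type*} [TopologicalSpace M] [ChartedSpace (EuclideanSpace ℝ (Fin 2)) M]

/-! ### First order geometry of a map from a surface to Minkowski space -/

/-- The differential of `f` at `p`. -/
def diff (f : M → V4) (p : M) : TangentSpace (𝓡 2) p →L[ℝ] V4 :=
  mfderiv (𝓡 2) 𝓘(ℝ, V4) f p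

/-- The symmetric bilinear form that `f` induces on the tangent plane at `p`. -/
def metric (f : M → V4) (p : M) (u v : TangentSpace (𝓡 2) p) : ℝ :=
  mink (diff f p u) (diff f p v)

/-- `f` is a smooth timelike immersion: the induced form has signature `(1, 1)` on every tangent
plane (so that the differential is injective). -/
structure IsTimelikeImmersion (f : M → V4) : Prop where
  smooth : ContMDiff (𝓡 2) 𝓘(ℝ, V4) ∞ f
  lorentzian : ∀ p : M, ∃ b : Module.Basis (Fin 2) ℝ (TangentSpace (𝓡 2) p),
    metric f p (b 0) (b 0) = -1 ∧ metric f p (b 1) (b 1) = 1 ∧ metric f p (b 0) (b 1) = 0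

/-- The standard basis of the tangent plane at `p` (the coordinate vectors of the preferred chart). -/
def coordVec (p : M) (i : Fin 2) : TangentSpace (𝓡 2) p :=
  (EuclideanSpace.single i (1 : ℝ) : EuclideanSpace ℝ (Fin 2))

/-- The matrix `g_ij` of the induced metric at `p`. -/
def gram (f : M → V4) (p : M) : Matrix (Fin 2) (Fin 2) ℝ :=
  Matrix.of fun i j => metric f p (coordVec p i) (coordVec p j)

/-- The tangent part at `p` of a vector `v` of Minkowski space. -/
def tangentPart (f : M → V4) (p : M) (v : V4) : TangentSpace (𝓡 2) p :=
  ∑ i, ∑ j, ((gram f p)⁻¹ i j * mink v (diff f p (coordVec p j))) • coordVec p i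

/-- The normal part at `p` of a vector `v` of Minkowski space. -/
def normalPart (f : M → V4) (p : M) (v : V4) : V4 :=
  v - diff f p (tangentPart f p v)

/-- The constant vector field `Z` defines a canonical null direction: its tangent part is lightlike
(nonzero and null) at every point. -/
def HasCanonicalNullDirection (f : M → V4) (Z : V4) : Prop :=
  ∀ p : M, tangentPart f p Z ≠ 0 ∧ metric f p (tangentPart f p Z) (tangentPart f p Z) = 0

/-! ### Second order geometry -/

/-- The derivative of a map `ξ` with values in Minkowski space in the direction of `u`: the
flat connection along the surface. -/
def flatDeriv (ξ : M → V4) (p : M) (u : TangentSpace (𝓡 2) p) : V4 :=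
  mfderiv (𝓡 2) 𝓘(ℝ, V4) ξ p u

/-- Extension of a tangent vector at `p` to the vector field near `p` whose components are constant
in the preferred chart at `p`. -/
def extend [IsManifold (𝓡 2) ∞ M] (p : M) (v : TangentSpace (𝓡 2) p) (q : M) :
    TangentSpace (𝓡 2) q :=
  tangentCoordChange (𝓡 2) p q q v

/-- The second fundamental form: the normal part of the flat derivative, in the direction of `u`, of
a vector field that extends `v`. -/
def secondFF [IsManifold (𝓡 2) ∞ M] (f : M → V4) (p : M) (u v : TangentSpace (𝓡 2) p) : V4 :=
  normalPart f p (flatDeriv (fun q => diff f q (extend p v q)) p u)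

/-- The mean curvature vector, half the metric trace of the second fundamental form. -/
def meanCurvature [IsManifold (𝓡 2) ∞ M] (f : M → V4) (p : M) : V4 :=
  (1 / 2 : ℝ) • ∑ i, ∑ j, (gram f p)⁻¹ i j • secondFF f p (coordVec p i) (coordVec p j)

/-- The normal connection `∇^⊥_X ξ`. -/
def normalDeriv (f : M → V4) (X : ∀ q : M, TangentSpace (𝓡 2) q) (ξ : M → V4) (p : M) : V4 :=
  normalPart f p (flatDeriv ξ p (X p))

/-- The curvature of the normal connection,
`R^⊥(X, Y) ξ = ∇^⊥_Y ∇^⊥_X ξ - ∇^⊥_X ∇^⊥_Y ξ + ∇^⊥_[X, Y] ξ`. -/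
def normalCurvature (f : M → V4) (X Y : ∀ q : M, TangentSpace (𝓡 2) q) (ξ : M → V4) (p : M) : V4 :=
  normalDeriv f Y (normalDeriv f X ξ) p - normalDeriv f X (normalDeriv f Y ξ) p
    + normalDeriv f (VectorField.mlieBracket (𝓡 2) X Y) ξ p

/-- Smoothness at `p` of a vector field on the surface. -/
def SmoothFieldAt [IsManifold (𝓡 2) ∞ M] (X : ∀ q : M, TangentSpace (𝓡 2) q) (p : M) : Prop :=
  ContMDiffAt (𝓡 2) (𝓡 2).tangent ∞ (fun q => (⟨q, X q⟩ : TangentBundle (𝓡 2) M)) p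

/-- The normal curvature tensor vanishes at `p`. -/
def NormalFlatAt [IsManifold (𝓡 2) ∞ M] (f : M → V4) (p : M) : Prop :=
  ∀ (X Y : ∀ q : M, TangentSpace (𝓡 2) q) (ξ : M → V4),
    SmoothFieldAt X p → SmoothFieldAt Y p → ContMDiffAt (𝓡 2) 𝓘(ℝ, V4) ∞ ξ p →
    (∀ᶠ q in 𝓝 p, ∀ u : TangentSpace (𝓡 2) q, mink (ξ q) (diff f q u) = 0) →
    normalCurvature f X Y ξ p = 0

/-! ### The Gauss map and asymptotic directions -/

/-- A choice of an orientation of every tangent plane is an orientation of the surface if, for `q`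
near `p`, the transition from the preferred chart at `p` to the one at `q` preserves or reverses the
standard orientation of the plane according as `o q` and `o p` agree or not when both tangent
planes are read in their preferred charts. -/
def IsSurfaceOrientation [IsManifold (𝓡 2) ∞ M]
    (o : ∀ p : M, Orientation ℝ (TangentSpace (𝓡 2) p) (Fin 2)) : Prop :=
  ∀ p : M, ∀ᶠ q in 𝓝 p,
    ((show Orientation ℝ (EuclideanSpace ℝ (Fin 2)) (Fin 2) from o q) =
        (show Orientation ℝ (EuclideanSpace ℝ (Fin 2)) (Fin 2) from o p) ↔
      0 < (tangentCoordChange (𝓡 2) p q q).det)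

/-- `b` is a positively oriented orthonormal basis of the tangent plane at `p`, the timelike vector
being the first one. -/
def IsPositiveFrame (f : M → V4) (o : ∀ p : M, Orientation ℝ (TangentSpace (𝓡 2) p) (Fin 2)) (p : M)
    (b : Module.Basis (Fin 2) ℝ (TangentSpace (𝓡 2) p)) : Prop :=
  b.orientation = o p ∧
    metric f p (b 0) (b 0) = -1 ∧ metric f p (b 1) (b 1) = 1 ∧ metric f p (b 0) (b 1) = 0

open Classical in
/-- The oriented Gauss map `p ↦ u₁ ∧ u₂`, for any positively oriented orthonormal basis `(u₁, u₂)`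
of the tangent plane at `p`. -/
def gaussMap (f : M → V4) (o : ∀ p : M, Orientation ℝ (TangentSpace (𝓡 2) p) (Fin 2)) (p : M) :
    Bivector :=
  if h : ∃ b, IsPositiveFrame f o p b then
    wedge (diff f p (h.choose 0)) (diff f p (h.choose 1))
  else 0

/-- The quadratic form `δ(u) = dG(u) ∧ dG(u)` on the tangent plane at `p`. -/
def delta (f : M → V4) (o : ∀ p : M, Orientation ℝ (TangentSpace (𝓡 2) p) (Fin 2)) (p : M)
    (u : TangentSpace (𝓡 2) p) : ℝ :=
  let dG : TangentSpace (𝓡 2) p →L[ℝ] Bivector :=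
    mfderiv (𝓡 2) 𝓘(ℝ, Bivector) (gaussMap f o) p
  wedgeWedge (dG u) (dG u)

/-- A nonzero tangent vector `u` defines an asymptotic direction if `δ(u) = 0`. -/
def IsAsymptotic (f : M → V4) (o : ∀ p : M, Orientation ℝ (TangentSpace (𝓡 2) p) (Fin 2)) (p : M)
    (u : TangentSpace (𝓡 2) p) : Prop :=
  u ≠ 0 ∧ delta f o p u = 0

end

end NullDir

open NullDir

namespace NullDir

noncomputable section

/-! ### Algebra of the Minkowski product and of bivectors -/

/-! Near a point the Gauss map is a sign times (-det g)^(-1/2) times ∂₁f ∧ ∂₂f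
(`IsTimelikeImmersion.gaussMap_eq`). In dG(u) ∧ dG(u) the derivative of the scalar factor drops out,
and what survives is a nonzero multiple of the volume of ∂₁f, ∂₂f, II(u, ∂₁), II(u, ∂₂). Hence, for
any basis a, b of the tangent plane, δ(u) = 0 means that II(u, a) and II(u, b) are linearly
dependent in the normal plane (`IsTimelikeImmersion.delta_eq_zero_iff`).

Take a = Z^⊤, b = W and let n be the normal part of Z. Since Z^⊤ is null, ⟨n, n⟩ = ⟨Z, Z⟩ = 1. Since
Z is constant, differentiating ⟨Z^⊤, Z^⊤⟩ = 0 along u gives ⟨n, II(u, Z^⊤)⟩ = 0 (`local_null`). So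
II(a, a) and II(a, b) both lie in the line orthogonal to n in the normal plane: they are dependent,
and Z^⊤ is asymptotic.

As II(a, a) ≠ 0 spans that line, II(a, b) = c II(a, a) and II(b, b) = s n + t II(a, a). The volume
deciding whether W is asymptotic is then a nonzero multiple of cs. In a null basis H = -II(a, b), so
c = 0 is minimality (`IsTimelikeImmersion.meanCurvature_eq`). In the Ricci equation the mixed terms
II(a, b) cancel and R^⊥(a, b)ξ = ⟨II(b, b), ξ⟩ II(a, a) - ⟨II(a, a), ξ⟩ II(b, b), which vanishes for
all normal ξ exactly when s = 0 (`IsTimelikeImmersion.normalFlatAt_iff`). `normal_plane_algebra`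
contains this linear algebra.

The calculus is done for a field G of injective linear maps of a fixed plane, namely the derivative
of f read in the chart at p, and is carried to the surface by the coordinate changes. -/

theorem mink_comm (x y : V4) : mink x y = mink y x := by
  simp only [mink]; ring

theorem mink_add_left (x y z : V4) : mink (x + y) z = mink x z + mink y z := by
  simp only [mink, Pi.add_apply]; ring

theorem mink_sub_left (x y z : V4) : mink (x - y) z = mink x z - mink y z := by
  simp only [mink, Pi.sub_apply]; ring

theorem mink_smul_left (c : ℝ) (x y : V4) : mink (c • x) y = c * mink x y := by
  simp only [mink, Pi.smul_apply, smul_eq_mul]; ring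

theorem mink_add_right (x y z : V4) : mink x (y + z) = mink x y + mink x z := by
  simp only [mink, Pi.add_apply]; ring

theorem mink_sub_right (x y z : V4) : mink x (y - z) = mink x y - mink x z := by
  simp only [mink, Pi.sub_apply]; ring

theorem mink_smul_right (c : ℝ) (x y : V4) : mink x (c • y) = c * mink x y := by
  simp only [mink, Pi.smul_apply, smul_eq_mul]; ring

/-- The Minkowski product as a continuous bilinear map. -/
def minkL : V4 →L[ℝ] V4 →L[ℝ] ℝ :=
  (LinearMap.mk₂ ℝ mink mink_add_left mink_smul_left mink_add_right
    mink_smul_right).toContinuousBilinearMap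

@[simp] theorem minkL_apply (x y : V4) : minkL x y = mink x y := rfl

theorem mink_zero_left (x : V4) : mink 0 x = 0 := by simp [mink]

/-- The exterior product of two vectors as a bilinear map. -/
def wedgeLin : V4 →ₗ[ℝ] V4 →ₗ[ℝ] Bivector :=
  LinearMap.mk₂ ℝ wedge
    (fun x y z => by ext i j; simp [wedge]; ring) (fun c x y => by ext i j; simp [wedge]; ring)
    (fun x y z => by ext i j; simp [wedge]; ring) (fun c x y => by ext i j; simp [wedge]; ring)

/-- The volume of four vectors. -/
def vol (x y z w : V4) : ℝ := wedgeWedge (wedge x y) (wedge z w)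

theorem vol_eq_det (x y z w : V4) : vol x y z w = Matrix.det (Matrix.of ![x, y, z, w]) :=
  wedgeWedge_wedge x y z w

/-- This is the square of the derivative of a product r (x ∧ y). Every term with a repeated factor
vanishes, in particular all those containing the derivative of the scalar; only the two equal cross
terms (x' ∧ y) ∧ (x ∧ y') remain. -/
theorem wedgeWedge_derivative (r s : ℝ) (x y x' y' : V4) :
    wedgeWedge (r • wedge x y + s • (wedge x' y + wedge x y'))
      (r • wedge x y + s • (wedge x' y + wedge x y')) = -(2 * s ^ 2 * vol x y x' y') := by
  simp only [vol, wedgeWedge, wedge, Submodule.coe_add, Submodule.coe_smul, Pi.add_apply,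
    Pi.smul_apply, smul_eq_mul]
  ring

theorem vol_change_basis (a b c d : ℝ) (x y z w : V4) :
    vol (a • x + b • y) (c • x + d • y) (a • z + b • w) (c • z + d • w) =
      (a * d - b * c) ^ 2 * vol x y z w := by
  simp only [vol, wedgeWedge, wedge, Pi.add_apply, Pi.smul_apply, smul_eq_mul]
  ring

theorem vol_sub_tangent (a b c d : ℝ) (x y z w : V4) :
    vol x y (z - (a • x + b • y)) (w - (c • x + d • y)) = vol x y z w := by
  simp only [vol, wedgeWedge, wedge, Pi.add_apply, Pi.sub_apply, Pi.smul_apply, smul_eq_mul]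
  ring

/-- A vector orthogonal to four vectors of nonzero volume vanishes. -/
theorem eq_zero_of_orthogonal {x y z w n : V4} (h : vol x y z w ≠ 0) (hx : mink x n = 0)
    (hy : mink y n = 0) (hz : mink z n = 0) (hw : mink w n = 0) : n = 0 := by
  rw [vol_eq_det] at h
  by_contra hn
  -- Flipping the sign of the time coordinate of `n` turns Minkowski products into dot products, so
  -- the flipped vector is in the kernel of the matrix with rows x, y, z, w.
  refine h (Matrix.exists_mulVec_eq_zero_iff.mp ⟨![-n 0, n 1, n 2, n 3], ?_, ?_⟩)
  · intro h0
    apply hn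
    ext i
    have := congrFun h0 i
    fin_cases i <;> simpa using this
  · have key : ∀ v : V4, v ⬝ᵥ ![-n 0, n 1, n 2, n 3] = mink v n := by
      intro v
      simp [dotProduct, Fin.sum_univ_four, mink]
    ext i
    fin_cases i
    · exact (key x).trans hx
    · exact (key y).trans hy
    · exact (key z).trans hz
    · exact (key w).trans hw

/-- A nonzero vector orthogonal to a timelike one is spacelike. -/
theorem mink_self_pos_of_orthogonal {t v : V4} (ht : mink t t < 0) (hv : mink v t = 0)
    (hv0 : v ≠ 0) : 0 < mink v v := by
  simp only [mink] at *
  have cs : (v 0 * t 0) ^ 2 ≤ (v 1 ^ 2 + v 2 ^ 2 + v 3 ^ 2) * (t 1 ^ 2 + t 2 ^ 2 + t 3 ^ 2) := by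
    have : v 0 * t 0 = v 1 * t 1 + v 2 * t 2 + v 3 * t 3 := by linarith
    rw [this]
    nlinarith [sq_nonneg (v 1 * t 2 - v 2 * t 1), sq_nonneg (v 1 * t 3 - v 3 * t 1),
      sq_nonneg (v 2 * t 3 - v 3 * t 2)]
  have ht0 : 0 < t 0 ^ 2 := by nlinarith [sq_nonneg (t 1), sq_nonneg (t 2), sq_nonneg (t 3)]
  have hS : 0 < v 1 ^ 2 + v 2 ^ 2 + v 3 ^ 2 := by
    by_contra hS
    have h1 : v 1 = 0 := by
      apply pow_eq_zero_iff (two_ne_zero) |>.mp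
      nlinarith [sq_nonneg (v 1), sq_nonneg (v 2), sq_nonneg (v 3)]
    have h2 : v 2 = 0 := by
      apply pow_eq_zero_iff (two_ne_zero) |>.mp
      nlinarith [sq_nonneg (v 1), sq_nonneg (v 2), sq_nonneg (v 3)]
    have h3 : v 3 = 0 := by
      apply pow_eq_zero_iff (two_ne_zero) |>.mp
      nlinarith [sq_nonneg (v 1), sq_nonneg (v 2), sq_nonneg (v 3)]
    have h0 : v 0 = 0 := by
      rw [h1, h2, h3] at hv
      have : v 0 * t 0 = 0 := by linarith
      rcases mul_eq_zero.mp this with h | h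
      · exact h
      · simp [h] at ht0
    exact hv0 (by ext i; fin_cases i <;> simp [h0, h1, h2, h3])
  have h2 : (v 1 ^ 2 + v 2 ^ 2 + v 3 ^ 2) * (t 1 ^ 2 + t 2 ^ 2 + t 3 ^ 2) <
      (v 1 ^ 2 + v 2 ^ 2 + v 3 ^ 2) * t 0 ^ 2 := by
    apply mul_lt_mul_of_pos_left _ hS
    linarith
  have h3 : v 0 ^ 2 < v 1 ^ 2 + v 2 ^ 2 + v 3 ^ 2 := by
    refine lt_of_mul_lt_mul_right ?_ ht0.le
    calc v 0 ^ 2 * t 0 ^ 2 = (v 0 * t 0) ^ 2 := by ring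
      _ < _ := lt_of_le_of_lt cs h2
  linarith

/-- Two null vectors with product `-1`, completed by a unit vector `n` and a further spacelike
vector `m`, all orthogonal to one another, have nonzero volume. -/
theorem vol_ne_zero_of_orthogonal {x y n m : V4} (hxx : mink x x = 0) (hyy : mink y y = 0)
    (hxy : mink x y = -1) (hxn : mink x n = 0) (hyn : mink y n = 0) (hxm : mink x m = 0)
    (hym : mink y m = 0) (hnn : mink n n = 1) (hmm : 0 < mink m m) (hnm : mink n m = 0) :
    vol x y n m ≠ 0 := by
  rw [vol_eq_det]
  intro hdet
  obtain ⟨c, hc0, hc⟩ := Matrix.exists_vecMul_eq_zero_iff.mpr hdet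
  have hsum : c 0 • x + c 1 • y + c 2 • n + c 3 • m = 0 := by
    ext i
    have := congrFun hc i
    simpa [Matrix.vecMul, dotProduct, Fin.sum_univ_four] using this
  -- Pairing the vanishing combination with y, x, n and m isolates the four coefficients in turn.
  have pair : ∀ z, c 0 * mink x z + c 1 * mink y z + c 2 * mink n z + c 3 * mink m z = 0 := by
    intro z
    rw [← mink_zero_left z, ← hsum]
    simp only [mink_add_left, mink_smul_left]
  have h0 := pair y
  have h1 := pair x
  have h2 := pair n
  have h3 := pair m
  rw [mink_comm n y, mink_comm m y, hxy, hyy, hyn, hym] at h0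
  rw [mink_comm n x, mink_comm m x, mink_comm y x, hxy, hxx, hxn, hxm] at h1
  rw [mink_comm m n, hxn, hyn, hnn, hnm] at h2
  rw [hxm, hym, hnm] at h3
  have h3' : c 3 = 0 := by
    have : c 3 * mink m m = 0 := by linarith
    exact (mul_eq_zero.mp this).resolve_right hmm.ne'
  apply hc0
  ext i
  fin_cases i <;> simp <;> linarith

/-- In the normal plane of a timelike plane with null basis `x, y`, with second fundamental form
`xx, xy, yy` whose first two values are orthogonal to a unit vector `n`. -/
theorem normal_plane_algebra {x y n xx xy yy : V4} (hxx : mink x x = 0) (hyy : mink y y = 0)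
    (hxy : mink x y = -1) (hxn : mink x n = 0) (hyn : mink y n = 0) (hnn : mink n n = 1)
    (hx_xx : mink x xx = 0) (hy_xx : mink y xx = 0) (hx_xy : mink x xy = 0) (hy_xy : mink y xy = 0)
    (hx_yy : mink x yy = 0) (hy_yy : mink y yy = 0) (hn_xx : mink n xx = 0)
    (hn_xy : mink n xy = 0) (hne : xx ≠ 0) :
    vol x y xx xy = 0 ∧ (vol x y xy yy = 0 ↔
      xy = 0 ∨ ∀ ξ, mink x ξ = 0 → mink y ξ = 0 → mink yy ξ • xx = mink xx ξ • yy) := by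
  -- The vector x + y is timelike, of square -2, and xx is orthogonal to it.
  have hmm : 0 < mink xx xx := by
    refine mink_self_pos_of_orthogonal (t := x + y) ?_ ?_ hne
    · simp only [mink_add_left, mink_add_right, hxx, hyy, mink_comm y x, hxy]; norm_num
    · rw [mink_comm, mink_add_left, hx_xx, hy_xx, add_zero]
  have hvol := vol_ne_zero_of_orthogonal hxx hyy hxy hxn hyn hx_xx hy_xx hnn hmm hn_xx
  have expand : ∀ v, mink x v = 0 → mink y v = 0 →
      v = mink n v • n + (mink xx v / mink xx xx) • xx := by
    intro v h1 h2
    rw [← sub_eq_zero]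
    apply eq_zero_of_orthogonal hvol <;>
      simp only [mink_sub_right, mink_add_right, mink_smul_right, h1, h2, hxn, hyn, hx_xx, hy_xx,
        hnn, hn_xx, mink_comm xx n]
    · ring
    · ring
    · ring
    · field_simp; ring
  have e1 := expand xy hx_xy hy_xy
  have e2 := expand yy hx_yy hy_yy
  rw [hn_xy, zero_smul, zero_add] at e1
  generalize mink xx xy / mink xx xx = c at e1
  generalize mink xx yy / mink xx xx = t at e2
  generalize mink n yy = s at e2
  subst e1 e2
  constructor
  · simp only [vol, wedgeWedge, wedge, Pi.smul_apply, smul_eq_mul]; ring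
  have hv : vol x y (c • xx) (s • n + t • xx) = -(c * s) * vol x y n xx := by
    simp only [vol, wedgeWedge, wedge, Pi.add_apply, Pi.smul_apply, smul_eq_mul]; ring
  rw [hv, mul_eq_zero, or_iff_left hvol, neg_eq_zero, mul_eq_zero, smul_eq_zero, or_iff_left hne]
  refine or_congr_right ⟨?_, ?_⟩
  · rintro rfl ξ - -
    simp only [mink_add_left, mink_smul_left]
    module
  -- Testing on ξ = xx and pairing with n leaves only s ⟨xx, xx⟩ = 0.
  · intro h
    have := congrArg (mink n) (h xx hx_xx hy_xx)
    simp only [mink_add_left, mink_add_right, mink_smul_right, mink_smul_left, hn_xx, hnn] at this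
    have h' : s * mink xx xx = 0 := by linarith
    exact (mul_eq_zero.mp h').resolve_right hmm.ne'

/-! ### Timelike planes given by a linear parametrization -/

/-- The model of the tangent planes. -/
abbrev Plane : Type := EuclideanSpace ℝ (Fin 2)

/-- The standard basis of the model plane. -/
def stdVec (i : Fin 2) : Plane := EuclideanSpace.single i (1 : ℝ)

theorem plane_eq (u : Plane) : u = u 0 • stdVec 0 + u 1 • stdVec 1 := by
  ext i; fin_cases i <;> simp [stdVec]

/-- The Gram matrix of a linear map from the model plane. -/
def gramOf (G : Plane →L[ℝ] V4) : Matrix (Fin 2) (Fin 2) ℝ :=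
  Matrix.of fun i j => mink (G (stdVec i)) (G (stdVec j))

/-- The coordinates of the tangent part of `v`. -/
def tanOf (G : Plane →L[ℝ] V4) (v : V4) : Plane :=
  ∑ i, ∑ j, ((gramOf G)⁻¹ i j * mink v (G (stdVec j))) • stdVec i

/-- The part of `v` normal to the range of `G`. -/
def norOf (G : Plane →L[ℝ] V4) (v : V4) : V4 := v - G (tanOf G v)

/-- The range of `G` is a timelike plane. -/
def IsTimelike (G : Plane →L[ℝ] V4) : Prop :=
  ∃ b : Module.Basis (Fin 2) ℝ Plane,
    mink (G (b 0)) (G (b 0)) = -1 ∧ mink (G (b 1)) (G (b 1)) = 1 ∧ mink (G (b 0)) (G (b 1)) = 0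

theorem map_plane (G : Plane →L[ℝ] V4) (u : Plane) :
    G u = u 0 • G (stdVec 0) + u 1 • G (stdVec 1) := by
  conv_lhs => rw [plane_eq u]
  simp

/-- The Gram determinant of two vectors of the range of `G`. -/
theorem gram_change_basis (G : Plane →L[ℝ] V4) (u v : Plane) :
    mink (G u) (G u) * mink (G v) (G v) - mink (G u) (G v) ^ 2 =
      (u 0 * v 1 - u 1 * v 0) ^ 2 * (gramOf G).det := by
  rw [map_plane G u, map_plane G v, Matrix.det_fin_two]
  simp only [gramOf, Matrix.of_apply, mink_add_left, mink_add_right, mink_smul_left,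
    mink_smul_right, mink_comm (G (stdVec 1)) (G (stdVec 0))]
  ring

/-- An orthonormal frame has Gram determinant -1, which is a square times the Gram determinant of
the standard basis. -/
theorem IsTimelike.det_neg {G : Plane →L[ℝ] V4} (hG : IsTimelike G) : (gramOf G).det < 0 := by
  obtain ⟨b, h0, h1, h01⟩ := hG
  have := gram_change_basis G (b 0) (b 1)
  rw [h0, h1, h01] at this
  nlinarith [sq_nonneg (b 0 0 * b 1 1 - b 0 1 * b 1 0)]

theorem gramOf_isSymm (G : Plane →L[ℝ] V4) (i j : Fin 2) : gramOf G i j = gramOf G j i :=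
  mink_comm _ _

theorem tanOf_eq (G : Plane →L[ℝ] V4) (v : V4) :
    tanOf G v = (gramOf G).det⁻¹ •
      ((gramOf G 1 1 * mink v (G (stdVec 0)) - gramOf G 0 1 * mink v (G (stdVec 1))) • stdVec 0 +
      (gramOf G 0 0 * mink v (G (stdVec 1)) - gramOf G 0 1 * mink v (G (stdVec 0))) • stdVec 1) := by
  simp only [tanOf, Fin.sum_univ_two, Matrix.inv_def, Matrix.adjugate_fin_two, Ring.inverse_eq_inv',
    Matrix.smul_apply, Matrix.of_apply, Matrix.cons_val_zero, Matrix.cons_val_one,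
    Matrix.cons_val', smul_eq_mul, gramOf_isSymm G 1 0, Matrix.cons_val_fin_one]
  module

theorem mink_tanOf {G : Plane →L[ℝ] V4} (hG : IsTimelike G) (v : V4) (u : Plane) :
    mink (G (tanOf G v)) (G u) = mink v (G u) := by
  have hd := hG.det_neg.ne
  have hdet : (gramOf G).det = gramOf G 0 0 * gramOf G 1 1 - gramOf G 0 1 * gramOf G 0 1 := by
    rw [Matrix.det_fin_two, gramOf_isSymm G 1 0]
  have h10 := gramOf_isSymm G 1 0
  rw [tanOf_eq, map_plane G u]
  simp only [map_smul, map_add, mink_add_left, mink_add_right, mink_smul_left, mink_smul_right]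
  change _ * ((_ * (_ * gramOf G 0 0 + _ * gramOf G 1 0))) +
    _ * ((_ * (_ * gramOf G 0 1 + _ * gramOf G 1 1))) = _
  rw [h10]
  generalize (gramOf G).det = D at hd hdet
  field_simp
  rw [hdet]
  ring

theorem mink_norOf {G : Plane →L[ℝ] V4} (hG : IsTimelike G) (v : V4) (u : Plane) :
    mink (norOf G v) (G u) = 0 := by
  rw [norOf, mink_sub_left, mink_tanOf hG, sub_self]

theorem IsTimelike.eq_zero {G : Plane →L[ℝ] V4} (hG : IsTimelike G) {w : Plane}
    (h : ∀ u, mink (G w) (G u) = 0) : w = 0 := by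
  have hd := hG.det_neg.ne
  have hz : ∀ u : Plane, w 0 * u 1 - w 1 * u 0 = 0 := by
    intro u
    have := gram_change_basis G w u
    rw [h w, h u] at this
    have h2 : (w 0 * u 1 - w 1 * u 0) ^ 2 * (gramOf G).det = 0 := by linarith
    exact pow_eq_zero_iff two_ne_zero |>.mp ((mul_eq_zero.mp h2).resolve_right hd)
  have h0 := hz (stdVec 0)
  have h1 := hz (stdVec 1)
  simp [stdVec] at h0 h1
  ext i; fin_cases i <;> simp [h0, h1]

theorem IsTimelike.tanOf_unique {G : Plane →L[ℝ] V4} (hG : IsTimelike G) {v : V4} {w : Plane}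
    (h : ∀ u, mink (G w) (G u) = mink v (G u)) : tanOf G v = w := by
  rw [← sub_eq_zero]
  apply hG.eq_zero
  intro u
  rw [map_sub, mink_sub_left, mink_tanOf hG, h, sub_self]

/-- The projection onto a timelike plane does not depend on its parametrization. This allows
`tangentPart` at q, defined by the chart at q, to be computed in the chart at p. -/
theorem tanOf_comp {G : Plane →L[ℝ] V4} (T : Plane ≃L[ℝ] Plane) (hG : IsTimelike G)
    (v : V4) : T (tanOf (G.comp (T : Plane →L[ℝ] Plane)) v) = tanOf G v := by
  have hGT : IsTimelike (G.comp (T : Plane →L[ℝ] Plane)) := by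
    obtain ⟨b, hb⟩ := hG
    exact ⟨b.map T.symm.toLinearEquiv, by simpa using hb⟩
  refine (hG.tanOf_unique fun u => ?_).symm
  have := mink_tanOf hGT v (T.symm u)
  simpa using this

theorem norOf_add (G : Plane →L[ℝ] V4) (v w : V4) : norOf G (v + w) = norOf G v + norOf G w := by
  have : tanOf G (v + w) = tanOf G v + tanOf G w := by
    simp only [tanOf_eq, mink_add_left]; module
  rw [norOf, this, map_add, norOf, norOf]; abel

theorem norOf_smul (G : Plane →L[ℝ] V4) (c : ℝ) (v : V4) : norOf G (c • v) = c • norOf G v := by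
  have : tanOf G (c • v) = c • tanOf G v := by
    simp only [tanOf_eq, mink_smul_left]; module
  rw [norOf, this, map_smul, norOf, smul_sub]

theorem norOf_sub (G : Plane →L[ℝ] V4) (v w : V4) : norOf G (v - w) = norOf G v - norOf G w := by
  have := norOf_smul G (-1) w
  rw [neg_one_smul, neg_one_smul] at this
  rw [sub_eq_add_neg, norOf_add, this, sub_eq_add_neg]

theorem norOf_map {G : Plane →L[ℝ] V4} (hG : IsTimelike G) (u : Plane) : norOf G (G u) = 0 := by
  rw [norOf, hG.tanOf_unique (w := u) fun _ => rfl, sub_self]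

theorem norOf_of_normal {G : Plane →L[ℝ] V4} (hG : IsTimelike G) {v : V4}
    (h : ∀ u, mink v (G u) = 0) : norOf G v = v := by
  rw [norOf, hG.tanOf_unique (w := 0) fun u => ?_]
  · simp
  · rw [h, map_zero, mink_zero_left]

/-- Expansion in a null basis. -/
theorem null_expand {G : Plane →L[ℝ] V4} {a b : Plane}
    (haa : mink (G a) (G a) = 0) (hbb : mink (G b) (G b) = 0) (hab : mink (G a) (G b) = -1)
    (w : Plane) : w = -mink (G w) (G b) • a - mink (G w) (G a) • b := by
  have key := gram_change_basis G a b
  have hdet : a 0 * b 1 - a 1 * b 0 ≠ 0 := by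
    intro h
    rw [h, haa, hbb, hab] at key
    norm_num at key
  have hw : ∃ s t : ℝ, w = s • a + t • b := by
    -- Cramer's rule.
    refine ⟨(w 0 * b 1 - w 1 * b 0) / (a 0 * b 1 - a 1 * b 0),
      (a 0 * w 1 - a 1 * w 0) / (a 0 * b 1 - a 1 * b 0), ?_⟩
    generalize hD : a 0 * b 1 - a 1 * b 0 = D at hdet
    ext i
    fin_cases i <;> simp <;> field_simp <;> rw [← hD] <;> ring
  obtain ⟨s, t, rfl⟩ := hw
  simp only [map_add, map_smul, mink_add_left, mink_smul_left, haa, hbb, hab,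
    mink_comm (G b) (G a)]
  module


section

/-! ### Local calculus of a parametrized timelike surface -/

theorem contDiffAt_mink {n : WithTop ℕ∞} {x₀ : Plane} {V W : Plane → V4}
    (hV : ContDiffAt ℝ n V x₀) (hW : ContDiffAt ℝ n W x₀) :
    ContDiffAt ℝ n (fun x => mink (V x) (W x)) x₀ :=
  (contDiffAt_const (c := minkL)).clm_apply hV |>.clm_apply hW

theorem fderiv_mink {x₀ : Plane} {V W : Plane → V4} (hV : DifferentiableAt ℝ V x₀)
    (hW : DifferentiableAt ℝ W x₀) (u : Plane) :
    fderiv ℝ (fun x => mink (V x) (W x)) x₀ u =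
      mink (fderiv ℝ V x₀ u) (W x₀) + mink (V x₀) (fderiv ℝ W x₀ u) := by
  have h := minkL.hasFDerivAt_of_bilinear hV.hasFDerivAt hW.hasFDerivAt
  have h' : fderiv ℝ (fun x => mink (V x) (W x)) x₀ = _ := h.fderiv
  rw [h']
  simp [add_comm]

variable {G : Plane → Plane →L[ℝ] V4} {x₀ : Plane}

theorem contDiffAt_gramOf_det {n : WithTop ℕ∞} (hG : ContDiffAt ℝ n G x₀) :
    ContDiffAt ℝ n (fun x => (gramOf (G x)).det) x₀ := by
  have hv : ∀ i, ContDiffAt ℝ n (fun x => G x (stdVec i)) x₀ := fun i =>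
    hG.clm_apply contDiffAt_const
  simp only [Matrix.det_fin_two, gramOf, Matrix.of_apply]
  exact ((contDiffAt_mink (hv _) (hv _)).mul (contDiffAt_mink (hv _) (hv _))).sub
    ((contDiffAt_mink (hv _) (hv _)).mul (contDiffAt_mink (hv _) (hv _)))

theorem contDiffAt_tanOf {n : WithTop ℕ∞} (hG : ContDiffAt ℝ n G x₀) (hT : IsTimelike (G x₀))
    {V : Plane → V4} (hV : ContDiffAt ℝ n V x₀) :
    ContDiffAt ℝ n (fun x => tanOf (G x) (V x)) x₀ := by
  have hv : ∀ i, ContDiffAt ℝ n (fun x => G x (stdVec i)) x₀ := fun i =>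
    hG.clm_apply contDiffAt_const
  simp only [tanOf_eq, gramOf, Matrix.of_apply]
  refine ((contDiffAt_gramOf_det hG).inv hT.det_neg.ne).fun_smul (.add ?_ ?_) <;>
  · refine ContDiffAt.fun_smul (.sub ?_ ?_) contDiffAt_const <;>
    exact (contDiffAt_mink (hv _) (hv _)).mul (contDiffAt_mink hV (hv _))

theorem contDiffAt_norOf {n : WithTop ℕ∞} (hG : ContDiffAt ℝ n G x₀) (hT : IsTimelike (G x₀))
    {V : Plane → V4} (hV : ContDiffAt ℝ n V x₀) :
    ContDiffAt ℝ n (fun x => norOf (G x) (V x)) x₀ :=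
  hV.sub (hG.clm_apply (contDiffAt_tanOf hG hT hV))

theorem fderiv_clm_apply_apply {V : Plane → Plane} {F' : Type*} [NormedAddCommGroup F']
    [NormedSpace ℝ F'] {G : Plane → Plane →L[ℝ] F'} (hG : DifferentiableAt ℝ G x₀)
    (hV : DifferentiableAt ℝ V x₀) (u : Plane) :
    fderiv ℝ (fun x => G x (V x)) x₀ u = fderiv ℝ G x₀ u (V x₀) + G x₀ (fderiv ℝ V x₀ u) := by
  rw [(hG.hasFDerivAt.clm_apply hV.hasFDerivAt).fderiv]
  simp [add_comm]

/-- The normal part of the derivative of the normal part of a field. -/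
theorem norOf_fderiv_norOf (hG : ContDiffAt ℝ 1 G x₀) (hT : IsTimelike (G x₀)) {V : Plane → V4}
    (hV : ContDiffAt ℝ 1 V x₀) (u : Plane) :
    norOf (G x₀) (fderiv ℝ (fun x => norOf (G x) (V x)) x₀ u) =
      norOf (G x₀) (fderiv ℝ V x₀ u) -
        norOf (G x₀) (fderiv ℝ G x₀ u (tanOf (G x₀) (V x₀))) := by
  have ht := (contDiffAt_tanOf hG hT hV).differentiableAt one_ne_zero
  have hGd := hG.differentiableAt one_ne_zero
  have hVd := hV.differentiableAt one_ne_zero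
  simp only [norOf.eq_1 (G _) (V _)]
  rw [fderiv_fun_sub hVd (hGd.clm_apply ht)]
  -- The derivative of the tangent coordinates is mapped by G x₀ into the tangent plane, hence is
  -- killed by the normal projection.
  rw [sub_apply, fderiv_clm_apply_apply hGd ht, norOf_sub, norOf_add,
    norOf_map hT, add_zero]

/-- The Ricci equation for a local parametrization. -/
theorem local_ricci (hG : ContDiffAt ℝ 1 G x₀) (hT : IsTimelike (G x₀)) {ξ : Plane → V4}
    (hξ : ContDiffAt ℝ 2 ξ x₀) {X Y : Plane → Plane} (hX : ContDiffAt ℝ 1 X x₀)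
    (hY : ContDiffAt ℝ 1 Y x₀) :
    norOf (G x₀) (fderiv ℝ (fun x => norOf (G x) (fderiv ℝ ξ x (X x))) x₀ (Y x₀)) -
      norOf (G x₀) (fderiv ℝ (fun x => norOf (G x) (fderiv ℝ ξ x (Y x))) x₀ (X x₀)) +
      norOf (G x₀) (fderiv ℝ ξ x₀ (VectorField.lieBracket ℝ X Y x₀)) =
    norOf (G x₀) (fderiv ℝ G x₀ (X x₀) (tanOf (G x₀) (fderiv ℝ ξ x₀ (Y x₀)))) -
      norOf (G x₀) (fderiv ℝ G x₀ (Y x₀) (tanOf (G x₀) (fderiv ℝ ξ x₀ (X x₀)))) := by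
  have hdξ : ContDiffAt ℝ 1 (fderiv ℝ ξ) x₀ := hξ.fderiv_right (by norm_num)
  have hdξd := hdξ.differentiableAt one_ne_zero
  have hXd := hX.differentiableAt one_ne_zero
  have hYd := hY.differentiableAt one_ne_zero
  -- The second derivatives of ξ cancel by symmetry and the derivatives of X and Y cancel against
  -- the bracket; only the corrections from the inner normal projections survive.
  rw [norOf_fderiv_norOf hG hT (hdξ.clm_apply hX), norOf_fderiv_norOf hG hT (hdξ.clm_apply hY),
    fderiv_clm_apply_apply hdξd hXd, fderiv_clm_apply_apply hdξd hYd, VectorField.lieBracket,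
    map_sub, norOf_sub, norOf_add, norOf_add,
    (hξ.isSymmSndFDerivAt (by simp)).eq (X x₀) (Y x₀)]
  abel

/-- The tangent part of the derivative of a normal field. -/
theorem mink_fderiv_normal (hG : DifferentiableAt ℝ G x₀) {ξ : Plane → V4}
    (hξ : DifferentiableAt ℝ ξ x₀) (u v : Plane) (h : ∀ᶠ x in 𝓝 x₀, mink (ξ x) (G x v) = 0) :
    mink (fderiv ℝ ξ x₀ u) (G x₀ v) = -mink (ξ x₀) (fderiv ℝ G x₀ u v) := by
  have h0 : fderiv ℝ (fun x => mink (ξ x) (G x v)) x₀ u = 0 := by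
    have : (fun x => mink (ξ x) (G x v)) =ᶠ[𝓝 x₀] fun _ => 0 := h
    rw [this.fderiv_eq]; simp
  rw [fderiv_mink hξ (hG.clm_apply (differentiableAt_const v)),
    fderiv_clm_apply_apply hG (differentiableAt_const v)] at h0
  simp at h0
  linarith

theorem mink_norOf_of_normal {G : Plane →L[ℝ] V4} {ξ : V4} (h : ∀ u, mink ξ (G u) = 0) (v : V4) :
    mink ξ (norOf G v) = mink ξ v := by
  rw [norOf, mink_sub_right, h, sub_zero]

/-- If the tangent part of `Z` is null near `x₀`, then the derivatives of the tangent part have no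
component along the normal part. -/
theorem local_null (hG : DifferentiableAt ℝ G x₀) (hT : IsTimelike (G x₀)) {Z : V4}
    (hnull : ∀ᶠ x in 𝓝 x₀, ∃ t, mink (G x t) (G x t) = 0 ∧ ∀ u, mink (G x t) (G x u) = mink Z (G x u))
    (hne : tanOf (G x₀) Z ≠ 0) (u : Plane) :
    mink (norOf (G x₀) Z) (fderiv ℝ G x₀ u (tanOf (G x₀) Z)) = 0 := by
  set a := tanOf (G x₀) Z with ha
  have haZ : ∀ u, mink (G x₀ a) (G x₀ u) = mink Z (G x₀ u) := mink_tanOf hT Z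
  -- N is orthogonal to the tangent part of Z, and ⟨N, N⟩ is det g times the square of that tangent
  -- part. It is therefore null near x₀ as well, and it is differentiated without inverting the Gram
  -- matrix.
  set N : Plane → V4 := fun x => mink Z (G x (stdVec 1)) • G x (stdVec 0) -
    mink Z (G x (stdVec 0)) • G x (stdVec 1) with hN
  have hN0 : ∀ᶠ x in 𝓝 x₀, mink (N x) (N x) = 0 := by
    filter_upwards [hnull] with x ⟨t, ht, htZ⟩
    rw [map_plane (G x) t] at ht htZ
    simp only [hN, ← htZ]
    simp only [mink_add_left, mink_sub_left, mink_smul_left, mink_add_right, mink_sub_right,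
      mink_smul_right, mink_comm (G x (stdVec 1)) (G x (stdVec 0))] at ht ⊢
    linear_combination (mink (G x (stdVec 0)) (G x (stdVec 0)) *
      mink (G x (stdVec 1)) (G x (stdVec 1)) - mink (G x (stdVec 0)) (G x (stdVec 1)) ^ 2) * ht
  have hv : ∀ v, DifferentiableAt ℝ (fun x => G x v) x₀ := fun v =>
    hG.clm_apply (differentiableAt_const v)
  have hdv : ∀ v, fderiv ℝ (fun x => G x v) x₀ u = fderiv ℝ G x₀ u v := fun v => by
    rw [fderiv_clm_apply_apply hG (differentiableAt_const v)]; simp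
  have hz : ∀ v, DifferentiableAt ℝ (fun x => mink Z (G x v)) x₀ := fun v =>
    (minkL Z).differentiableAt.comp x₀ (hv v)
  have hdz : ∀ v, fderiv ℝ (fun x => mink Z (G x v)) x₀ u = mink Z (fderiv ℝ G x₀ u v) := fun v => by
    rw [fderiv_mink (differentiableAt_const Z) (hv v), hdv]; simp [mink_zero_left]
  have hNd : DifferentiableAt ℝ N x₀ := ((hz _).fun_smul (hv _)).sub ((hz _).fun_smul (hv _))
  have hdN : fderiv ℝ N x₀ u =
      (mink Z (fderiv ℝ G x₀ u (stdVec 1)) • G x₀ (stdVec 0) +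
        mink Z (G x₀ (stdVec 1)) • fderiv ℝ G x₀ u (stdVec 0)) -
      (mink Z (fderiv ℝ G x₀ u (stdVec 0)) • G x₀ (stdVec 1) +
        mink Z (G x₀ (stdVec 0)) • fderiv ℝ G x₀ u (stdVec 1)) := by
    rw [hN, fderiv_fun_sub ((hz _).fun_smul (hv _)) ((hz _).fun_smul (hv _)),
      fderiv_fun_smul (hz _) (hv _), fderiv_fun_smul (hz _) (hv _)]
    simp [hdz, hdv, add_comm]
  have h0 : mink (fderiv ℝ N x₀ u) (N x₀) = 0 := by
    have : (fun x => mink (N x) (N x)) =ᶠ[𝓝 x₀] fun _ => 0 := hN0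
    have h := fderiv_mink hNd hNd u
    rw [this.fderiv_eq, mink_comm (N x₀)] at h
    simp at h
    linarith
  have haa : mink (G x₀ a) (G x₀ a) = 0 := by
    obtain ⟨t, ht, htZ⟩ := hnull.self_of_nhds
    rw [ha, hT.tanOf_unique htZ, ht]
  set z₀ := mink Z (G x₀ (stdVec 0)) with hz₀
  set z₁ := mink Z (G x₀ (stdVec 1)) with hz₁
  have hza : z₀ * a 0 + z₁ * a 1 = 0 := by
    rw [← haa, haZ, map_plane (G x₀) a, mink_add_right, mink_smul_right, mink_smul_right]
    ring
  -- By `hza` the pair (z₁, -z₀) is proportional to (a 0, a 1). Thus N is k times the tangent part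
  -- of Z at x₀, and ⟨dN, N⟩ = 0 becomes the claim multiplied by k².
  obtain ⟨k, hk1, hk0⟩ : ∃ k, z₁ = k * a 0 ∧ z₀ = -(k * a 1) := by
    by_cases h : a 0 = 0
    · have h1 : a 1 ≠ 0 := fun h1 => hne (by ext i; fin_cases i <;> simp [h, h1])
      refine ⟨-z₀ / a 1, ?_, by field_simp⟩
      rw [h] at hza ⊢
      simpa [h1] using hza
    · refine ⟨z₁ / a 0, by field_simp, ?_⟩
      field_simp
      linarith
  have hk : k ≠ 0 := by
    rintro rfl
    refine hne (hT.eq_zero fun u => ?_)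
    rw [haZ, map_plane (G x₀) u, mink_add_right, mink_smul_right, mink_smul_right, ← hz₀, ← hz₁,
      hk0, hk1]
    ring
  have hNx : N x₀ = k • G x₀ a := by
    simp only [hN, ← hz₀, ← hz₁, hk0, hk1, map_plane (G x₀) a]
    module
  rw [hNx, hdN, hk0, hk1] at h0
  have key : k ^ 2 * mink (norOf (G x₀) Z) (fderiv ℝ G x₀ u a) = 0 := by
    rw [norOf, ← ha, mink_comm, map_plane (fderiv ℝ G x₀ u) a]
    simp only [mink_add_left, mink_sub_left, mink_smul_left, mink_sub_right,
      mink_smul_right, mink_comm (fderiv ℝ G x₀ u _) Z] at h0 ⊢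
    rw [mink_comm (G x₀ (stdVec 0)), mink_comm (G x₀ (stdVec 1)), haZ, haZ, ← hz₀, ← hz₁, hk0,
      hk1] at h0
    linear_combination -h0
  exact (mul_eq_zero.mp key).resolve_left (pow_ne_zero 2 hk)

theorem differentiableAt_smul_bilinear {B : Type*} [NormedAddCommGroup B] [NormedSpace ℝ B]
    (L : V4 →ₗ[ℝ] V4 →ₗ[ℝ] B) {r : Plane → ℝ} {V W : Plane → V4}
    (hr : DifferentiableAt ℝ r x₀) (hV : DifferentiableAt ℝ V x₀)
    (hW : DifferentiableAt ℝ W x₀) :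
    DifferentiableAt ℝ (fun x => r x • L (V x) (W x)) x₀ ∧
    ∀ u, fderiv ℝ (fun x => r x • L (V x) (W x)) x₀ u =
      fderiv ℝ r x₀ u • L (V x₀) (W x₀) +
      r x₀ • (L (fderiv ℝ V x₀ u) (W x₀) + L (V x₀) (fderiv ℝ W x₀ u)) := by
  have h := L.toContinuousBilinearMap.hasFDerivAt_of_bilinear hV.hasFDerivAt hW.hasFDerivAt
  have h' : HasFDerivAt (fun x => r x • L (V x) (W x)) _ x₀ := hr.hasFDerivAt.fun_smul h
  refine ⟨h'.differentiableAt, fun u => ?_⟩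
  rw [h'.fderiv]
  simp [add_comm]

/-- A multiple of `V ∧ W` is differentiable, and the square of its derivative is a volume. -/
theorem wedgeWedge_fderiv {r : Plane → ℝ} {V W : Plane → V4} (hr : DifferentiableAt ℝ r x₀)
    (hV : DifferentiableAt ℝ V x₀) (hW : DifferentiableAt ℝ W x₀) :
    DifferentiableAt ℝ (fun x => r x • wedge (V x) (W x)) x₀ ∧
    ∀ u, wedgeWedge (fderiv ℝ (fun x => r x • wedge (V x) (W x)) x₀ u)
      (fderiv ℝ (fun x => r x • wedge (V x) (W x)) x₀ u) =
    -(2 * r x₀ ^ 2 * vol (V x₀) (W x₀) (fderiv ℝ V x₀ u) (fderiv ℝ W x₀ u)) := by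
  obtain ⟨h, h'⟩ := differentiableAt_smul_bilinear wedgeLin hr hV hW
  refine ⟨h, fun u => ?_⟩
  rw [← wedgeWedge_derivative (fderiv ℝ r x₀ u)]
  exact congrArg₂ wedgeWedge (h' u) (h' u)

/-- The volume of the values of a parametrization and of its second fundamental form on any
basis. -/
theorem vol_norOf (G B : Plane →L[ℝ] V4) (a b : Plane) :
    vol (G a) (G b) (norOf G (B a)) (norOf G (B b)) = (a 0 * b 1 - a 1 * b 0) ^ 2 *
      vol (G (stdVec 0)) (G (stdVec 1)) (B (stdVec 0)) (B (stdVec 1)) := by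
  have h : ∀ v, norOf G v =
      v - (tanOf G v 0 • G (stdVec 0) + tanOf G v 1 • G (stdVec 1)) := fun v => by
    rw [norOf, ← map_plane]
  rw [map_plane G a, map_plane G b, map_plane B a, map_plane B b, norOf_add, norOf_add, norOf_smul,
    norOf_smul, norOf_smul, norOf_smul, vol_change_basis, h, h, vol_sub_tangent]

end

section

/-! ### Reading maps and fields in a chart -/

variable {M : Type*} [TopologicalSpace M] [ChartedSpace (EuclideanSpace ℝ (Fin 2)) M]

/-- A map on the surface, read in the preferred chart at `p`. -/
def inChart {B : Type*} (p : M) (ξ : M → B) (x : Plane) : B := ξ ((extChartAt (𝓡 2) p).symm x)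

theorem inChart_apply {B : Type*} {p q : M} (hq : q ∈ (extChartAt (𝓡 2) p).source) (ξ : M → B) :
    inChart p ξ (extChartAt (𝓡 2) p q) = ξ q := by
  rw [inChart, (extChartAt (𝓡 2) p).left_inv hq]

theorem eventually_inChart {p : M} {P : M → Prop} (h : ∀ᶠ q in 𝓝 p, P q) :
    ∀ᶠ x in 𝓝 (extChartAt (𝓡 2) p p), P ((extChartAt (𝓡 2) p).symm x) := by
  have hc := continuousAt_extChartAt_symm (I := 𝓡 2) p
  rw [ContinuousAt, extChartAt_to_inv] at hc
  exact hc.eventually h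

theorem eventually_target (p : M) :
    ∀ᶠ x in 𝓝 (extChartAt (𝓡 2) p p), x ∈ (extChartAt (𝓡 2) p).target :=
  extChartAt_target_mem_nhds p

theorem eventuallyEq_inChart (p : M) {B : Type*} (ξ : M → B) :
    (fun q => inChart p ξ (extChartAt (𝓡 2) p q)) =ᶠ[𝓝 p] ξ := by
  filter_upwards [extChartAt_source_mem_nhds (I := 𝓡 2) p] with q hq
  exact inChart_apply hq ξ

theorem eventuallyEq_of_source {B : Type*} {p : M} {ξ : M → B} {η : Plane → B}
    (h : ∀ᶠ q in 𝓝 p, q ∈ (extChartAt (𝓡 2) p).source → ξ q = η (extChartAt (𝓡 2) p q)) :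
    inChart p ξ =ᶠ[𝓝 (extChartAt (𝓡 2) p p)] η := by
  filter_upwards [eventually_inChart h, eventually_target p] with x hx hxt
  have := hx ((extChartAt (𝓡 2) p).map_target hxt)
  rwa [(extChartAt (𝓡 2) p).right_inv hxt] at this

/-- The differential of `f` on the model plane. -/
def planeDiff (f : M → V4) (q : M) : Plane →L[ℝ] V4 := diff f q

theorem tangentPart_eq (f : M → V4) (q : M) (v : V4) :
    tangentPart f q v = tanOf (planeDiff f q) v := rfl

theorem normalPart_eq (f : M → V4) (q : M) (v : V4) :
    normalPart f q v = norOf (planeDiff f q) v := rfl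

theorem IsTimelikeImmersion.isTimelike {f : M → V4} (hf : IsTimelikeImmersion f) (q : M) :
    IsTimelike (planeDiff f q) :=
  hf.lorentzian q

variable {B : Type*} [NormedAddCommGroup B] [NormedSpace ℝ B]

theorem contMDiffAt_of_inChart {n : ℕ∞} {p : M} {ξ : M → B}
    (h : ContDiffAt ℝ n (inChart p ξ) (extChartAt (𝓡 2) p p)) :
    ContMDiffAt (𝓡 2) 𝓘(ℝ, B) n ξ p := by
  have h1 : ContMDiffAt (𝓡 2) 𝓘(ℝ, Plane) n (extChartAt (𝓡 2) p) p :=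
    (contMDiffAt_extChartAt (n := ∞)).of_le (by exact_mod_cast le_top)
  exact (h.contMDiffAt.comp p h1).congr_of_eventuallyEq (eventuallyEq_inChart p ξ).symm

variable [IsManifold (𝓡 2) ∞ M]

/-- The coordinate change from the chart at `p` to the chart at `q`, at the point `q`. -/
def chartChange (p q : M) (hq : q ∈ (extChartAt (𝓡 2) p).source) : Plane ≃L[ℝ] Plane :=
  ContinuousLinearEquiv.equivOfInverse (tangentCoordChange (𝓡 2) p q q)
    (tangentCoordChange (𝓡 2) q p q)
    (fun v => by
      rw [tangentCoordChange_comp ⟨⟨hq, mem_extChartAt_source q⟩, hq⟩, tangentCoordChange_self hq])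
    (fun v => by
      rw [tangentCoordChange_comp ⟨⟨mem_extChartAt_source q, hq⟩, mem_extChartAt_source q⟩,
        tangentCoordChange_self (mem_extChartAt_source q)])

/-- The tangent space at q is read in the preferred chart at q, so the differential of the inverse
chart at p is a transition map, and is the identity only at q = p. -/
theorem hasMFDerivAt_extChartAt_symm {p q : M} (hq : q ∈ (extChartAt (𝓡 2) p).source) :
    HasMFDerivAt 𝓘(ℝ, Plane) (𝓡 2) (extChartAt (𝓡 2) p).symm (extChartAt (𝓡 2) p q)
      (tangentCoordChange (𝓡 2) p q q) := by
  have hx : extChartAt (𝓡 2) p q ∈ (extChartAt (𝓡 2) p).target := (extChartAt (𝓡 2) p).map_source hq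
  refine ⟨continuousAt_extChartAt_symm'' hx, ?_⟩
  have h := hasFDerivWithinAt_tangentCoordChange (I := 𝓡 2) ⟨hq, mem_extChartAt_source (I := 𝓡 2) q⟩
  have e : (extChartAt (𝓡 2) p).symm (extChartAt (𝓡 2) p q) = q := (extChartAt (𝓡 2) p).left_inv hq
  rw [writtenInExtChartAt, e]
  simp only [extChartAt_model_space_eq_id, PartialEquiv.refl_coe, PartialEquiv.refl_symm,
    Function.comp_id, id_eq, modelWithCornersSelf_coe, Set.range_id] at h ⊢
  exact h

theorem hasFDerivAt_inChart {p q : M} (hq : q ∈ (extChartAt (𝓡 2) p).source) {ξ : M → B}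
    (hξ : MDifferentiableAt (𝓡 2) 𝓘(ℝ, B) ξ q) :
    HasFDerivAt (inChart p ξ)
      ((show Plane →L[ℝ] B from mfderiv (𝓡 2) 𝓘(ℝ, B) ξ q).comp
        (chartChange p q hq : Plane →L[ℝ] Plane)) (extChartAt (𝓡 2) p q) := by
  have e : (extChartAt (𝓡 2) p).symm (extChartAt (𝓡 2) p q) = q := (extChartAt (𝓡 2) p).left_inv hq
  have h1 := hasMFDerivAt_extChartAt_symm hq
  have h2 : ∀ q', q' = q → HasMFDerivAt (𝓡 2) 𝓘(ℝ, B) ξ q'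
      (show Plane →L[ℝ] B from mfderiv (𝓡 2) 𝓘(ℝ, B) ξ q) := by
    rintro _ rfl
    exact hξ.hasMFDerivAt
  exact hasMFDerivAt_iff_hasFDerivAt.mp (HasMFDerivAt.comp _ (h2 _ e) h1)

theorem fderiv_inChart {p q : M} (hq : q ∈ (extChartAt (𝓡 2) p).source) {ξ : M → B}
    (hξ : MDifferentiableAt (𝓡 2) 𝓘(ℝ, B) ξ q) (v : Plane) :
    fderiv ℝ (inChart p ξ) (extChartAt (𝓡 2) p q) v =
      (mfderiv (𝓡 2) 𝓘(ℝ, B) ξ q : Plane →L[ℝ] B) (chartChange p q hq v) := by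
  rw [(hasFDerivAt_inChart hq hξ).fderiv]; rfl

theorem mdifferentiableAt_of_inChart {p : M} {ξ : M → B}
    (h : DifferentiableAt ℝ (inChart p ξ) (extChartAt (𝓡 2) p p)) :
    MDifferentiableAt (𝓡 2) 𝓘(ℝ, B) ξ p := by
  have h1 : MDifferentiableAt (𝓡 2) 𝓘(ℝ, Plane) (extChartAt (𝓡 2) p) p :=
    mdifferentiableAt_extChartAt (mem_chart_source _ p)
  exact (h.mdifferentiableAt.comp p h1).congr_of_eventuallyEq (eventuallyEq_inChart p ξ).symm

theorem chartChange_self (p : M) (v : Plane) :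
    chartChange p p (mem_extChartAt_source p) v = v :=
  tangentCoordChange_self (mem_extChartAt_source p)

theorem mfderiv_eq_fderiv_inChart {p : M} {ξ : M → B}
    (h : DifferentiableAt ℝ (inChart p ξ) (extChartAt (𝓡 2) p p)) (u : Plane) :
    (mfderiv (𝓡 2) 𝓘(ℝ, B) ξ p : Plane →L[ℝ] B) u =
      fderiv ℝ (inChart p ξ) (extChartAt (𝓡 2) p p) u := by
  rw [fderiv_inChart (mem_extChartAt_source p) (mdifferentiableAt_of_inChart h), chartChange_self]

theorem contDiffAt_inChart {n : ℕ∞} {p q : M} (hq : q ∈ (extChartAt (𝓡 2) p).source) {ξ : M → B}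
    (h : ContMDiffAt (𝓡 2) 𝓘(ℝ, B) n ξ q) :
    ContDiffAt ℝ n (inChart p ξ) (extChartAt (𝓡 2) p q) := by
  have hx : extChartAt (𝓡 2) p q ∈ (extChartAt (𝓡 2) p).target := (extChartAt (𝓡 2) p).map_source hq
  have h1 : ContMDiffAt 𝓘(ℝ, Plane) (𝓡 2) n (extChartAt (𝓡 2) p).symm (extChartAt (𝓡 2) p q) :=
    ((contMDiffOn_extChartAt_symm (n := ∞) p).contMDiffAt
      ((isOpen_extChartAt_target p).mem_nhds hx)).of_le (by exact_mod_cast le_top)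
  have e : (extChartAt (𝓡 2) p).symm (extChartAt (𝓡 2) p q) = q := (extChartAt (𝓡 2) p).left_inv hq
  exact (ContMDiffAt.comp_of_eq h h1 e).contDiffAt

/-- A vector field on the surface, read in the preferred chart at `p`. -/
def fieldInChart (p : M) (X : ∀ q : M, TangentSpace (𝓡 2) q) (x : Plane) : Plane :=
  VectorField.mpullbackWithin 𝓘(ℝ, Plane) (𝓡 2) (extChartAt (𝓡 2) p).symm X
    (Set.range (𝓡 2)) x

theorem chartChange_fieldInChart {p q : M} (hq : q ∈ (extChartAt (𝓡 2) p).source)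
    (X : ∀ q : M, TangentSpace (𝓡 2) q) :
    chartChange p q hq (fieldInChart p X (extChartAt (𝓡 2) p q)) = X q := by
  have e : (extChartAt (𝓡 2) p).symm (extChartAt (𝓡 2) p q) = q := (extChartAt (𝓡 2) p).left_inv hq
  have hm : (mfderivWithin 𝓘(ℝ, Plane) (𝓡 2) (extChartAt (𝓡 2) p).symm
      (Set.range (𝓡 2)) (extChartAt (𝓡 2) p q) : Plane →L[ℝ] Plane) =
      (chartChange p q hq : Plane →L[ℝ] Plane) := by
    rw [ModelWithCorners.range_eq_univ, mfderivWithin_univ]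
    exact (hasMFDerivAt_extChartAt_symm hq).mfderiv
  have key : fieldInChart p X (extChartAt (𝓡 2) p q) =
      ContinuousLinearMap.inverse (chartChange p q hq : Plane →L[ℝ] Plane)
        (X ((extChartAt (𝓡 2) p).symm (extChartAt (𝓡 2) p q)) : Plane) := by
    rw [← hm]; rfl
  rw [key, ContinuousLinearMap.inverse_equiv]
  have : ∀ q', q' = q → chartChange p q hq ((chartChange p q hq).symm (X q' : Plane)) = X q := by
    rintro _ rfl
    exact (chartChange p _ hq).apply_symm_apply _
  exact this _ e

theorem fieldInChart_self (p : M) (X : ∀ q : M, TangentSpace (𝓡 2) q) :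
    fieldInChart p X (extChartAt (𝓡 2) p p) = X p := by
  rw [← chartChange_fieldInChart (mem_extChartAt_source p) X, chartChange_self]

theorem contDiffAt_fieldInChart {p : M} {X : ∀ q : M, TangentSpace (𝓡 2) q}
    (hX : SmoothFieldAt X p) : ContDiffAt ℝ 1 (fieldInChart p X) (extChartAt (𝓡 2) p p) := by
  have h := VectorField.contMDiffWithinAt_mpullbackWithin_extChartAt_symm (I := 𝓡 2) (n := ∞) (m := 1)
    (s := Set.univ) (x := p) (V := X)
    ((show ContMDiffAt _ _ _ _ p from hX).of_le (by exact_mod_cast le_top)).contMDiffWithinAt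
    uniqueMDiffOn_univ (Set.mem_univ _) (by norm_cast)
  refine contMDiffAt_vectorSpace_iff_contDiffAt.mp (h.contMDiffAt ?_)
  simpa using extChartAt_target_mem_nhds (I := 𝓡 2) p

theorem inverse_apply_of_eq_id {T : Plane →L[ℝ] Plane} (h : T = ContinuousLinearMap.id ℝ Plane)
    (v : Plane) : T.inverse v = v := by
  rw [h, ContinuousLinearMap.inverse_id]; rfl

/-- The manifold bracket is by definition the bracket of the pullbacks used in `fieldInChart`,
brought back by the inverse differential of the chart, which is the identity at p. -/
theorem mlieBracket_eq (p : M) (X Y : ∀ q : M, TangentSpace (𝓡 2) q) :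
    VectorField.mlieBracket (𝓡 2) X Y p =
      VectorField.lieBracket ℝ (fieldInChart p X) (fieldInChart p Y) (extChartAt (𝓡 2) p p) := by
  have hi : (mfderiv (𝓡 2) 𝓘(ℝ, Plane) (extChartAt (𝓡 2) p) p : Plane →L[ℝ] Plane) =
      ContinuousLinearMap.id ℝ Plane := mfderiv_extChartAt_self
  rw [← VectorField.mlieBracketWithin_univ, VectorField.mlieBracketWithin_apply]
  refine (inverse_apply_of_eq_id hi _).trans ?_
  change VectorField.lieBracketWithin ℝ (fieldInChart p X) (fieldInChart p Y)
      ((extChartAt (𝓡 2) p).symm ⁻¹' Set.univ ∩ Set.range (𝓡 2)) (extChartAt (𝓡 2) p p) = _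
  rw [Set.preimage_univ, Set.univ_inter, ModelWithCorners.range_eq_univ,
    VectorField.lieBracketWithin_univ]

end

section

/-! ### The geometry of a timelike immersion in a chart -/

variable {M : Type*} [TopologicalSpace M] [ChartedSpace (EuclideanSpace ℝ (Fin 2)) M]
  [IsManifold (𝓡 2) ∞ M]

/-- The differential of `f` in the preferred chart at `p`. -/
def chartDiff (p : M) (f : M → V4) : Plane → Plane →L[ℝ] V4 := fderiv ℝ (inChart p f)

variable {f : M → V4}

theorem IsTimelikeImmersion.chartDiff_eq (hf : IsTimelikeImmersion f) {p q : M}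
    (hq : q ∈ (extChartAt (𝓡 2) p).source) :
    chartDiff p f (extChartAt (𝓡 2) p q) =
      (planeDiff f q).comp (chartChange p q hq : Plane →L[ℝ] Plane) :=
  (hasFDerivAt_inChart hq ((hf.smooth q).mdifferentiableAt (by simp))).fderiv

theorem IsTimelikeImmersion.chartDiff_self (hf : IsTimelikeImmersion f) (p : M) :
    chartDiff p f (extChartAt (𝓡 2) p p) = planeDiff f p := by
  rw [hf.chartDiff_eq (mem_extChartAt_source p)]
  ext1 v
  simp [chartChange_self]

theorem IsTimelikeImmersion.isTimelike_chartDiff (hf : IsTimelikeImmersion f) {p q : M}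
    (hq : q ∈ (extChartAt (𝓡 2) p).source) :
    IsTimelike (chartDiff p f (extChartAt (𝓡 2) p q)) := by
  rw [hf.chartDiff_eq hq]
  obtain ⟨b, hb⟩ := hf.isTimelike q
  exact ⟨b.map (chartChange p q hq).symm.toLinearEquiv, by simpa using hb⟩

theorem IsTimelikeImmersion.contDiffAt_chart (hf : IsTimelikeImmersion f) (p : M) :
    ContDiffAt ℝ ∞ (inChart p f) (extChartAt (𝓡 2) p p) :=
  contDiffAt_inChart (mem_extChartAt_source p) (hf.smooth p)

theorem IsTimelikeImmersion.contDiffAt_chartDiff (hf : IsTimelikeImmersion f) (p : M) :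
    ContDiffAt ℝ ∞ (chartDiff p f) (extChartAt (𝓡 2) p p) :=
  (hf.contDiffAt_chart p).fderiv_right (by simp)

theorem IsTimelikeImmersion.normalPart_eq (hf : IsTimelikeImmersion f) {p q : M}
    (hq : q ∈ (extChartAt (𝓡 2) p).source) (v : V4) :
    normalPart f q v = norOf (chartDiff p f (extChartAt (𝓡 2) p q)) v := by
  rw [NullDir.normalPart_eq, norOf, norOf, hf.chartDiff_eq hq, ← tanOf_comp (chartChange p q hq)
    (hf.isTimelike q)]
  rfl

theorem two_le_infty : (2 : WithTop ℕ∞) ≤ ∞ :=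
  WithTop.coe_le_coe.mpr (le_top : (2 : ℕ∞) ≤ ⊤)

/-- The symmetric bilinear form of second derivatives in the preferred chart at `p`. -/
def hess (f : M → V4) (p : M) : Plane →L[ℝ] Plane →L[ℝ] V4 :=
  fderiv ℝ (chartDiff p f) (extChartAt (𝓡 2) p p)

theorem IsTimelikeImmersion.hess_symm (hf : IsTimelikeImmersion f) (p : M) (u v : Plane) :
    hess f p u v = hess f p v u :=
  (((hf.contDiffAt_chart p).of_le (m := 2) two_le_infty).isSymmSndFDerivAt
    (by simp)).eq u v

theorem flatDeriv_eq {ξ : M → V4} {p : M} {η : Plane → V4}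
    (h : inChart p ξ =ᶠ[𝓝 (extChartAt (𝓡 2) p p)] η)
    (hη : DifferentiableAt ℝ η (extChartAt (𝓡 2) p p)) (u : Plane) :
    flatDeriv ξ p u = fderiv ℝ η (extChartAt (𝓡 2) p p) u := by
  rw [← h.fderiv_eq]
  exact mfderiv_eq_fderiv_inChart (h.differentiableAt_iff.mpr hη) u

/-- In the chart at p the extension of v is constant, so the product rule leaves only the derivative
of the differential of f. -/
theorem IsTimelikeImmersion.secondFF_eq (hf : IsTimelikeImmersion f) (p : M) (u v : Plane) :
    secondFF f p u v = norOf (planeDiff f p) (hess f p u v) := by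
  have hd := (hf.contDiffAt_chartDiff p).differentiableAt (by simp)
  have h1 : inChart p (fun q => diff f q (extend p v q)) =ᶠ[𝓝 (extChartAt (𝓡 2) p p)]
      fun x => chartDiff p f x v := by
    refine eventuallyEq_of_source (.of_forall fun q hq => ?_)
    rw [hf.chartDiff_eq hq]; rfl
  change norOf (planeDiff f p) (flatDeriv _ p u) = _
  rw [flatDeriv_eq h1 (hd.clm_apply (differentiableAt_const v)),
    fderiv_clm_apply_apply hd (differentiableAt_const v)]
  simp only [fderiv_fun_const, Pi.zero_apply, zero_apply, map_zero, add_zero]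
  rfl

theorem IsTimelikeImmersion.normalDeriv_eq (hf : IsTimelikeImmersion f) {p q : M}
    (hq : q ∈ (extChartAt (𝓡 2) p).source) (X : ∀ q : M, TangentSpace (𝓡 2) q) {ξ : M → V4}
    (hξ : MDifferentiableAt (𝓡 2) 𝓘(ℝ, V4) ξ q) :
    normalDeriv f X ξ q = norOf (chartDiff p f (extChartAt (𝓡 2) p q))
      (fderiv ℝ (inChart p ξ) (extChartAt (𝓡 2) p q)
        (fieldInChart p X (extChartAt (𝓡 2) p q))) := by
  rw [normalDeriv, hf.normalPart_eq hq, fderiv_inChart hq hξ, chartChange_fieldInChart]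
  rfl

/-- The formula is needed on a neighbourhood, since the curvature differentiates it once more. -/
theorem IsTimelikeImmersion.inChart_normalDeriv (hf : IsTimelikeImmersion f) {p : M}
    (X : ∀ q : M, TangentSpace (𝓡 2) q) {ξ : M → V4} (hξ : ContMDiffAt (𝓡 2) 𝓘(ℝ, V4) ∞ ξ p) :
    inChart p (normalDeriv f X ξ) =ᶠ[𝓝 (extChartAt (𝓡 2) p p)] fun x =>
      norOf (chartDiff p f x) (fderiv ℝ (inChart p ξ) x (fieldInChart p X x)) := by
  refine eventuallyEq_of_source ?_
  have h1 : ContMDiffAt (𝓡 2) 𝓘(ℝ, V4) 1 ξ p := hξ.of_le (by exact_mod_cast (le_top : (_ : ℕ∞) ≤ ⊤))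
  filter_upwards [(contMDiffAt_iff_contMDiffAt_nhds (by simp)).mp h1] with q hq hqs
  exact hf.normalDeriv_eq hqs X (hq.mdifferentiableAt (by simp))

/-- The Ricci equation. -/
theorem IsTimelikeImmersion.normalCurvature_eq (hf : IsTimelikeImmersion f) {p : M}
    {X Y : ∀ q : M, TangentSpace (𝓡 2) q} (hX : SmoothFieldAt X p) (hY : SmoothFieldAt Y p)
    {ξ : M → V4} (hξ : ContMDiffAt (𝓡 2) 𝓘(ℝ, V4) ∞ ξ p) :
    normalCurvature f X Y ξ p =
      secondFF f p (X p) (tangentPart f p (flatDeriv ξ p (Y p))) -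
      secondFF f p (Y p) (tangentPart f p (flatDeriv ξ p (X p))) := by
  have hG : ContDiffAt ℝ 1 (chartDiff p f) (extChartAt (𝓡 2) p p) :=
    (hf.contDiffAt_chartDiff p).of_le (by exact_mod_cast (le_top : (_ : ℕ∞) ≤ ⊤))
  have hT := hf.isTimelike_chartDiff (mem_extChartAt_source (I := 𝓡 2) p)
  have hξ' : ContDiffAt ℝ 2 (inChart p ξ) (extChartAt (𝓡 2) p p) :=
    (contDiffAt_inChart (mem_extChartAt_source p) hξ).of_le two_le_infty
  have hdξ : ContDiffAt ℝ 1 (fderiv ℝ (inChart p ξ)) (extChartAt (𝓡 2) p p) :=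
    hξ'.fderiv_right (by norm_num)
  have hN : ∀ {X : ∀ q : M, TangentSpace (𝓡 2) q}, SmoothFieldAt X p → DifferentiableAt ℝ (fun x =>
      norOf (chartDiff p f x) (fderiv ℝ (inChart p ξ) x (fieldInChart p X x)))
      (extChartAt (𝓡 2) p p) := fun hX =>
    (contDiffAt_norOf hG hT (hdξ.clm_apply (contDiffAt_fieldInChart hX))).differentiableAt
      one_ne_zero
  have hξd := hξ'.differentiableAt two_ne_zero
  have key := local_ricci hG hT hξ' (contDiffAt_fieldInChart hX) (contDiffAt_fieldInChart hY)
  have hfl : ∀ u, flatDeriv ξ p u = fderiv ℝ (inChart p ξ) (extChartAt (𝓡 2) p p) u := fun u =>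
    flatDeriv_eq .rfl hξd u
  rw [fieldInChart_self, fieldInChart_self, hf.chartDiff_self, ← mlieBracket_eq] at key
  simp only [hfl]
  refine Eq.trans ?_ (key.trans (congrArg₂ (· - ·) (hf.secondFF_eq p _ _).symm
    (hf.secondFF_eq p _ _).symm))
  rw [normalCurvature]
  congr 1
  · congr 1
    · exact congrArg (norOf (planeDiff f p))
        (flatDeriv_eq (hf.inChart_normalDeriv X hξ) (hN hX) (Y p))
    · exact congrArg (norOf (planeDiff f p))
        (flatDeriv_eq (hf.inChart_normalDeriv Y hξ) (hN hY) (X p))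
  · exact congrArg (norOf (planeDiff f p)) (hfl _)

theorem smoothFieldAt_extend (p : M) (v : Plane) : SmoothFieldAt (extend p v) p := by
  refine (Bundle.contMDiffAt_section p).mpr ?_
  refine (contMDiffAt_const (c := v)).congr_of_eventuallyEq ?_
  filter_upwards [extChartAt_source_mem_nhds (I := 𝓡 2) p] with q hq
  exact (chartChange p q hq).symm_apply_apply v

theorem extend_self (p : M) (v : TangentSpace (𝓡 2) p) : extend p v p = v :=
  chartChange_self p v

/-- The normal part of a constant vector is a smooth normal field. -/
theorem IsTimelikeImmersion.contMDiffAt_normalPart (hf : IsTimelikeImmersion f) (p : M) (v : V4) :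
    ContMDiffAt (𝓡 2) 𝓘(ℝ, V4) ∞ (fun q => normalPart f q v) p := by
  refine contMDiffAt_of_inChart (ContDiffAt.congr_of_eventuallyEq
    (contDiffAt_norOf (hf.contDiffAt_chartDiff p)
      (hf.isTimelike_chartDiff (mem_extChartAt_source (I := 𝓡 2) p))
      (contDiffAt_const (c := v))) ?_)
  exact eventuallyEq_of_source (.of_forall fun q hq => hf.normalPart_eq hq v)

/-- The tangent part of the derivative of a normal field. -/
theorem IsTimelikeImmersion.mink_flatDeriv (hf : IsTimelikeImmersion f) {p : M} {ξ : M → V4}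
    (hξ : ContMDiffAt (𝓡 2) 𝓘(ℝ, V4) ∞ ξ p)
    (hn : ∀ᶠ q in 𝓝 p, ∀ u : TangentSpace (𝓡 2) q, mink (ξ q) (diff f q u) = 0) (u v : Plane) :
    mink (flatDeriv ξ p u) (planeDiff f p v) = -mink (ξ p) (secondFF f p u v) := by
  have hG := (hf.contDiffAt_chartDiff p).differentiableAt (by simp)
  have hξ' := (contDiffAt_inChart (mem_extChartAt_source p) hξ).differentiableAt (by simp)
  have h : ∀ᶠ x in 𝓝 (extChartAt (𝓡 2) p p), mink (inChart p ξ x) (chartDiff p f x v) = 0 := by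
    filter_upwards [eventually_inChart hn, eventually_target p] with x hx hxt
    have hs := (extChartAt (𝓡 2) p).map_target hxt
    have e := hf.chartDiff_eq hs
    rw [(extChartAt (𝓡 2) p).right_inv hxt] at e
    rw [e]
    exact hx (chartChange p _ hs v)
  have key := mink_fderiv_normal hG hξ' u v h
  rw [hf.chartDiff_self, inChart_apply (mem_extChartAt_source p)] at key
  rw [flatDeriv_eq .rfl hξ', key, hf.secondFF_eq,
    mink_norOf_of_normal (G := planeDiff f p) hn.self_of_nhds]
  rfl

/-- The mean curvature in a null basis. -/
theorem IsTimelikeImmersion.meanCurvature_eq (hf : IsTimelikeImmersion f) {p : M} {a b : Plane}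
    (haa : metric f p a a = 0) (hbb : metric f p b b = 0) (hab : metric f p a b = -1) :
    meanCurvature f p = -secondFF f p a b := by
  -- In a null basis with ⟨a, b⟩ = -1 the inverse metric is -(a ⊗ b + b ⊗ a); this is `null_expand`
  -- in coordinates.
  have hinv : (gram f p)⁻¹ = Matrix.of fun i j => -(a i * b j + b i * a j) := by
    refine Matrix.inv_eq_left_inv ?_
    ext i k
    have h := null_expand (G := planeDiff f p) haa hbb hab (stdVec k)
    have h' := congrFun (congrArg (fun w : Plane => w.ofLp) h) i
    simp only [map_plane (planeDiff f p) a, map_plane (planeDiff f p) b, mink_add_right,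
      mink_smul_right, PiLp.sub_apply, PiLp.smul_apply, smul_eq_mul] at h'
    have e : (1 : Matrix (Fin 2) (Fin 2) ℝ) i k = stdVec k i := by
      simp [Matrix.one_apply, stdVec]
    rw [e, h', Matrix.mul_apply, Fin.sum_univ_two]
    change -(_) * gramOf (planeDiff f p) 0 k + -(_) * gramOf (planeDiff f p) 1 k =
      -(_ * gramOf (planeDiff f p) k 0 + _ * gramOf (planeDiff f p) k 1) * _ -
        (_ * gramOf (planeDiff f p) k 0 + _ * gramOf (planeDiff f p) k 1) * _
    rw [gramOf_isSymm _ k 0, gramOf_isSymm _ k 1]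
    ring
  have hab' : secondFF f p a b = a 0 • b 0 • secondFF f p (stdVec 0) (stdVec 0) +
      (a 0 * b 1 + a 1 * b 0) • secondFF f p (stdVec 0) (stdVec 1) +
      a 1 • b 1 • secondFF f p (stdVec 1) (stdVec 1) := by
    simp only [hf.secondFF_eq]
    have : hess f p a b = a 0 • b 0 • hess f p (stdVec 0) (stdVec 0) +
      (a 0 * b 1 + a 1 * b 0) • hess f p (stdVec 0) (stdVec 1) +
      a 1 • b 1 • hess f p (stdVec 1) (stdVec 1) := by
      rw [map_plane (hess f p a) b, hf.hess_symm p a, hf.hess_symm p a,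
        map_plane (hess f p (stdVec 0)) a, map_plane (hess f p (stdVec 1)) a,
        hf.hess_symm p (stdVec 1) (stdVec 0)]
      module
    rw [this]
    simp only [norOf_add, norOf_smul]
  have hs : secondFF f p (stdVec 1) (stdVec 0) = secondFF f p (stdVec 0) (stdVec 1) := by
    rw [hf.secondFF_eq, hf.secondFF_eq, hf.hess_symm]
  rw [meanCurvature, hinv, hab']
  simp only [Fin.sum_univ_two, Matrix.of_apply]
  change (1 / 2 : ℝ) • (_ • secondFF f p (stdVec 0) (stdVec 0) +
    _ • secondFF f p (stdVec 0) (stdVec 1) + (_ • secondFF f p (stdVec 1) (stdVec 0) +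
    _ • secondFF f p (stdVec 1) (stdVec 1))) = _
  rw [hs]
  module

end

section

/-! ### The Gauss map -/

/-- The standard basis of the model plane. -/
def stdBasis : Module.Basis (Fin 2) ℝ Plane := (EuclideanSpace.basisFun (Fin 2) ℝ).toBasis

theorem stdBasis_det (v : Fin 2 → Plane) :
    stdBasis.det v = v 0 0 * v 1 1 - v 0 1 * v 1 0 := by
  rw [Module.Basis.det_apply, Matrix.det_fin_two]
  simp [stdBasis, Module.Basis.toMatrix_apply]
  ring

variable {M : Type*} [TopologicalSpace M] [ChartedSpace (EuclideanSpace ℝ (Fin 2)) M]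
variable {f : M → V4} {o : ∀ p : M, Orientation ℝ (TangentSpace (𝓡 2) p) (Fin 2)}

/-- Adjusting the orientation only changes signs of basis vectors, which preserves orthonormality.
-/
theorem IsTimelikeImmersion.exists_isPositiveFrame (hf : IsTimelikeImmersion f) (q : M) :
    ∃ b, IsPositiveFrame f o q b := by
  obtain ⟨b, h0, h1, h01⟩ := hf.lorentzian q
  refine ⟨b.adjustToOrientation (o q), b.orientation_adjustToOrientation (o q), ?_⟩
  have hneg : ∀ u v, metric f q (-u) v = -metric f q u v ∧ metric f q u (-v) = -metric f q u v := by
    intro u v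
    simp only [metric, map_neg, mink, Pi.neg_apply]
    constructor <;> ring
  rcases b.adjustToOrientation_apply_eq_or_eq_neg (o q) 0 with e0 | e0 <;>
  rcases b.adjustToOrientation_apply_eq_or_eq_neg (o q) 1 with e1 | e1 <;>
  simp only [e0, e1, (hneg _ _).1, (hneg _ _).2, h0, h1, h01, neg_neg, neg_zero, and_self]

variable [IsManifold (𝓡 2) ∞ M]

open Classical in
/-- The sign of an orientation of the plane. -/
def orientationSign (r : Orientation ℝ Plane (Fin 2)) : ℝ :=
  if r = stdBasis.orientation then 1 else -1

/-- The Gauss map near `p`. -/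
theorem IsTimelikeImmersion.gaussMap_eq (hf : IsTimelikeImmersion f) (ho : IsSurfaceOrientation o)
    (p : M) : ∀ᶠ q in 𝓝 p, q ∈ (extChartAt (𝓡 2) p).source → gaussMap f o q =
      (orientationSign (o p) * (√(-(gramOf (chartDiff p f (extChartAt (𝓡 2) p q))).det))⁻¹) •
        wedge (chartDiff p f (extChartAt (𝓡 2) p q) (stdVec 0))
          (chartDiff p f (extChartAt (𝓡 2) p q) (stdVec 1)) := by
  filter_upwards [ho p] with q hoq hq
  have hex := hf.exists_isPositiveFrame (o := o) q
  rw [gaussMap, dif_pos hex]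
  obtain ⟨hor, h0, h1, h01⟩ := hex.choose_spec
  generalize hex.choose = b at hor h0 h1 h01
  change mink (planeDiff f q (b 0)) (planeDiff f q (b 0)) = -1 at h0
  change mink (planeDiff f q (b 1)) (planeDiff f q (b 1)) = 1 at h1
  change mink (planeDiff f q (b 0)) (planeDiff f q (b 1)) = 0 at h01
  change wedge (planeDiff f q (b 0)) (planeDiff f q (b 1)) = _
  set T := chartChange p q hq with hT
  have hoq' : ((o q : Orientation ℝ Plane (Fin 2)) = (o p : Orientation ℝ Plane (Fin 2)) ↔
      0 < LinearMap.det (T.toLinearEquiv : Plane →ₗ[ℝ] Plane)) := hoq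
  set rq : Orientation ℝ Plane (Fin 2) := o q
  set rp : Orientation ℝ Plane (Fin 2) := o p
  let b' : Module.Basis (Fin 2) ℝ Plane := b
  have hor' : b'.orientation = rq := hor
  set c : Fin 2 → Plane := fun i => T.symm (b' i) with hc
  have hbc : ∀ i, planeDiff f q (b i) = chartDiff p f (extChartAt (𝓡 2) p q) (c i) := by
    intro i
    rw [hf.chartDiff_eq hq]
    simp only [ContinuousLinearMap.comp_apply, hc]
    exact congrArg (planeDiff f q) (T.apply_symm_apply (b' i)).symm
  rw [hbc] at h0 h01 ⊢
  rw [hbc] at h1 h01 ⊢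
  set G := chartDiff p f (extChartAt (𝓡 2) p q)
  have hdetb : stdBasis.det b' = LinearMap.det (T.toLinearEquiv : Plane →ₗ[ℝ] Plane) *
      stdBasis.det c := by
    rw [← Module.Basis.det_comp]
    congr 1
    ext1 i
    exact (T.apply_symm_apply (b' i)).symm
  have hdetT : LinearMap.det (T.toLinearEquiv : Plane →ₗ[ℝ] Plane) ≠ 0 :=
    (LinearEquiv.isUnit_det' T.toLinearEquiv).ne_zero
  generalize LinearMap.det (T.toLinearEquiv : Plane →ₗ[ℝ] Plane) = d at hoq' hdetb hdetT
  have hpos : rq = stdBasis.orientation ↔ 0 < stdBasis.det b' := by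
    rw [← hor', eq_comm, Module.Basis.orientation_eq_iff_det_pos]
  have hgram := gram_change_basis G (c 0) (c 1)
  rw [h0, h1, h01] at hgram
  -- The frame read in the chart at p has Gram determinant -1, which fixes its coordinate
  -- determinant up to sign. The orientation fixes the sign.
  have hsq : stdBasis.det c ^ 2 * -(gramOf G).det = 1 := by
    rw [stdBasis_det]; linarith
  have hwedge : wedge (G (c 0)) (G (c 1)) =
      stdBasis.det c • wedge (G (stdVec 0)) (G (stdVec 1)) := by
    rw [stdBasis_det, map_plane G (c 0), map_plane G (c 1)]
    ext i j
    simp [wedge]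
    ring
  rw [hwedge]
  congr 1
  generalize stdBasis.det c = e at hdetb hsq
  have hD : -(gramOf G).det = (e⁻¹) ^ 2 := by
    have : e ≠ 0 := by rintro rfl; norm_num at hsq
    field_simp
    linarith
  have he : e ≠ 0 := by rintro rfl; norm_num at hsq
  rw [hD, Real.sqrt_sq_eq_abs, abs_inv, inv_inv]
  rw [hdetb] at hpos
  have hd : 0 < d * e ↔ (0 < d ↔ 0 < e) := by
    rcases lt_or_gt_of_ne hdetT with hd | hd <;> rcases lt_or_gt_of_ne he with he | he
    · simp [mul_pos_of_neg_of_neg hd he, hd.not_gt, he.not_gt]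
    · simp [(mul_neg_of_neg_of_pos hd he).not_gt, hd.not_gt, he]
    · simp [(mul_neg_of_pos_of_neg hd he).not_gt, hd, he.not_gt]
    · simp [mul_pos hd he, hd, he]
  -- The frame determinant in the chart at q is d * e, and d > 0 exactly when the orientations at p
  -- and q agree. As a plane has only two orientations, the sign of e depends on p alone.
  have hsign : rp = stdBasis.orientation ↔ 0 < e := by
    have hq2 := stdBasis.orientation_ne_iff_eq_neg rq
    rcases stdBasis.orientation_eq_or_eq_neg rp with hp | hp
    · rw [hp] at hoq' ⊢
      tauto
    · have hne := (stdBasis.orientation_ne_iff_eq_neg rp).mpr hp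
      rw [hp] at hoq'
      tauto
  rw [orientationSign]
  split_ifs with h
  · rw [abs_of_pos (hsign.mp h), one_mul]
  · rw [abs_of_nonpos (not_lt.mp (fun h' => h (hsign.mpr h')))]; ring

theorem orientationSign_ne_zero (r : Orientation ℝ Plane (Fin 2)) : orientationSign r ≠ 0 := by
  rw [orientationSign]; split_ifs <;> norm_num

/-- Asymptotic directions in terms of the second fundamental form. -/
theorem IsTimelikeImmersion.delta_eq_zero_iff (hf : IsTimelikeImmersion f)
    (ho : IsSurfaceOrientation o) {p : M} {a b : Plane} (hab : a 0 * b 1 - a 1 * b 0 ≠ 0)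
    (u : Plane) : delta f o p u = 0 ↔
      vol (planeDiff f p a) (planeDiff f p b) (secondFF f p u a) (secondFF f p u b) = 0 := by
  have hG := (hf.contDiffAt_chartDiff p).differentiableAt (by simp)
  have hT := hf.isTimelike_chartDiff (mem_extChartAt_source (I := 𝓡 2) p)
  have hr : DifferentiableAt ℝ (fun x => orientationSign (o p) *
      (√(-(gramOf (chartDiff p f x)).det))⁻¹) (extChartAt (𝓡 2) p p) := by
    have h1 := (contDiffAt_gramOf_det (hf.contDiffAt_chartDiff p)).differentiableAt (by simp)
    have h2 := neg_pos.mpr hT.det_neg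
    exact ((h1.fun_neg.sqrt h2.ne').fun_inv (Real.sqrt_pos.mpr h2).ne').const_mul _
  have hv : ∀ v, DifferentiableAt ℝ (fun x => chartDiff p f x v) (extChartAt (𝓡 2) p p) := fun v =>
    hG.clm_apply (differentiableAt_const v)
  have hdv : ∀ v, fderiv ℝ (fun x => chartDiff p f x v) (extChartAt (𝓡 2) p p) u = hess f p u v :=
    fun v => by
      rw [fderiv_clm_apply_apply hG (differentiableAt_const v), hess]; simp
  -- Of the scalar factor only differentiability and nonvanishing at p matter.
  obtain ⟨hd, hw⟩ := wedgeWedge_fderiv hr (hv (stdVec 0)) (hv (stdVec 1))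
  have heq := eventuallyEq_of_source (η := fun x => (orientationSign (o p) *
      (√(-(gramOf (chartDiff p f x)).det))⁻¹) •
        wedge (chartDiff p f x (stdVec 0)) (chartDiff p f x (stdVec 1))) (hf.gaussMap_eq ho p)
  have hder : (mfderiv (𝓡 2) 𝓘(ℝ, Bivector) (gaussMap f o) p : Plane →L[ℝ] Bivector) u = _ :=
    (mfderiv_eq_fderiv_inChart (heq.differentiableAt_iff.mpr hd) u).trans
      (congrArg (fun L : Plane →L[ℝ] Bivector => L u) heq.fderiv_eq)
  have hdelta : delta f o p u = _ := (congrArg₂ wedgeWedge hder hder).trans (hw u)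
  rw [hdelta, hdv, hdv, hf.secondFF_eq, hf.secondFF_eq, vol_norOf, hf.chartDiff_self]
  have h3 : orientationSign (o p) * (√(-(gramOf (planeDiff f p)).det))⁻¹ ≠ 0 :=
    mul_ne_zero (orientationSign_ne_zero _)
      (inv_ne_zero (Real.sqrt_pos.mpr (neg_pos.mpr (hf.isTimelike p).det_neg)).ne')
  simp [h3, hab]

/-! ### Canonical null directions -/

/-- Infinitesimal form of the nullity of the tangent part of Z along the surface: `local_null`
applied in the chart at p. -/
theorem IsTimelikeImmersion.mink_normalPart_secondFF (hf : IsTimelikeImmersion f) {Z : V4}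
    (hnull : HasCanonicalNullDirection f Z) (p : M) (u : Plane) :
    mink (normalPart f p Z) (secondFF f p u (tangentPart f p Z)) = 0 := by
  have hG := (hf.contDiffAt_chartDiff p).differentiableAt (by simp)
  have hT := hf.isTimelike_chartDiff (mem_extChartAt_source (I := 𝓡 2) p)
  have h := local_null hG hT (Z := Z) ?_ ?_ u
  · rw [hf.chartDiff_self] at h
    have h2 := hf.secondFF_eq p u (tanOf (planeDiff f p) Z)
    refine (congrArg (mink (normalPart f p Z)) h2).trans ?_
    exact (mink_norOf_of_normal (mink_norOf (hf.isTimelike p) Z) _).trans h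
  · filter_upwards [eventually_target p] with x hxt
    have hs := (extChartAt (𝓡 2) p).map_target hxt
    have e := hf.chartDiff_eq hs
    rw [(extChartAt (𝓡 2) p).right_inv hxt] at e
    set q := (extChartAt (𝓡 2) p).symm x
    have hq := hf.isTimelike q
    have e1 : ∀ v, chartDiff p f x ((chartChange p q hs).symm v) = planeDiff f q v := fun v => by
      rw [e]
      exact congrArg (planeDiff f q) ((chartChange p q hs).apply_symm_apply v)
    refine ⟨(chartChange p q hs).symm (tanOf (planeDiff f q) Z), ?_, fun u => ?_⟩
    · rw [e1]; exact (hnull q).2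
    · rw [e1, e]
      exact mink_tanOf hq Z _
  · rw [hf.chartDiff_self]; exact (hnull p).1

/-- The normal curvature in a null basis. -/
theorem IsTimelikeImmersion.normalFlatAt_iff (hf : IsTimelikeImmersion f) {p : M} {a b : Plane}
    (haa : metric f p a a = 0) (hbb : metric f p b b = 0) (hab : metric f p a b = -1) :
    NormalFlatAt f p ↔ ∀ ξ, mink (planeDiff f p a) ξ = 0 → mink (planeDiff f p b) ξ = 0 →
      mink (secondFF f p b b) ξ • secondFF f p a a =
        mink (secondFF f p a a) ξ • secondFF f p b b := by
  have hnor : ∀ ξ, mink (planeDiff f p a) ξ = 0 → mink (planeDiff f p b) ξ = 0 →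
      ∀ u, mink ξ (planeDiff f p u) = 0 := by
    intro ξ h1 h2 u
    rw [null_expand (G := planeDiff f p) haa hbb hab u, map_sub, map_smul, map_smul,
      mink_sub_right, mink_smul_right, mink_smul_right, mink_comm ξ, mink_comm ξ, h1, h2]
    ring
  have hs : ∀ u v : Plane, secondFF f p u v = norOf (planeDiff f p) (hess f p u v) := hf.secondFF_eq p
  have hsymm : ∀ u v : Plane, secondFF f p u v = secondFF f p v u := fun u v => by
    rw [hs, hs, hf.hess_symm]
  have hlin : ∀ (s t : ℝ) (u v w : Plane), secondFF f p u (s • v - t • w : Plane) =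
      s • secondFF f p u v - t • secondFF f p u w := fun s t u v w => by
    rw [hs, hs, hs, map_sub, map_smul, map_smul, norOf_sub, norOf_smul, norOf_smul]
  have hcurv : ∀ (X Y : ∀ q : M, TangentSpace (𝓡 2) q) (ξ : M → V4),
      SmoothFieldAt X p → SmoothFieldAt Y p → ContMDiffAt (𝓡 2) 𝓘(ℝ, V4) ∞ ξ p →
      (∀ᶠ q in 𝓝 p, ∀ u : TangentSpace (𝓡 2) q, mink (ξ q) (diff f q u) = 0) →
      normalCurvature f X Y ξ p =
        (metric f p (X p) b * metric f p (Y p) a - metric f p (X p) a * metric f p (Y p) b) •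
        (mink (secondFF f p b b) (ξ p) • secondFF f p a a -
          mink (secondFF f p a a) (ξ p) • secondFF f p b b) := by
    intro X Y ξ hX hY hξ hn
    have htan : ∀ u : Plane, (tangentPart f p (flatDeriv ξ p u) : Plane) =
        mink (ξ p) (secondFF f p u b) • a - (-mink (ξ p) (secondFF f p u a)) • b := by
      intro u
      have h := null_expand (G := planeDiff f p) haa hbb hab
        (tanOf (planeDiff f p) (flatDeriv ξ p u))
      rw [mink_tanOf (hf.isTimelike p), mink_tanOf (hf.isTimelike p), hf.mink_flatDeriv hξ hn,
        hf.mink_flatDeriv hξ hn, neg_neg] at h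
      exact h
    have hsec : ∀ u w : Plane, secondFF f p u (tangentPart f p (flatDeriv ξ p w)) =
        mink (ξ p) (secondFF f p w b) • secondFF f p u a -
          (-mink (ξ p) (secondFF f p w a)) • secondFF f p u b := fun u w =>
      (congrArg (secondFF f p u) (htan w)).trans (hlin _ _ _ _ _)
    have hexp : ∀ u v : Plane, secondFF f p u v =
        -metric f p u b • secondFF f p a v - metric f p u a • secondFF f p b v := fun u v => by
      rw [hsymm a v, hsymm b v, hsymm u v, ← hlin]
      exact congrArg (secondFF f p v) (null_expand (G := planeDiff f p) haa hbb hab u)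
    refine (hf.normalCurvature_eq hX hY hξ).trans ?_
    refine (congrArg₂ (· - ·) (hsec (X p) (Y p)) (hsec (Y p) (X p))).trans ?_
    simp only [hexp (X p) a, hexp (X p) b, hexp (Y p) a, hexp (Y p) b, hsymm b a]
    simp only [mink_sub_right, mink_smul_right, mink_comm _ (ξ p)]
    module
  constructor
  · intro hflat ξ h1 h2
    have hξp : normalPart f p ξ = ξ := norOf_of_normal (hf.isTimelike p) (hnor ξ h1 h2)
    have hN : ∀ᶠ q in 𝓝 p, ∀ u : TangentSpace (𝓡 2) q,
        mink (normalPart f q ξ) (diff f q u) = 0 :=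
      .of_forall fun q u => mink_norOf (hf.isTimelike q) ξ u
    have ea : extend p a p = a := extend_self p a
    have eb : extend p b p = b := extend_self p b
    -- The test fields extend a and b, for which the scalar factor in `hcurv` equals 1, and the
    -- normal field is the normal part of the constant vector ξ.
    have h := hcurv _ _ _ (smoothFieldAt_extend p a) (smoothFieldAt_extend p b)
      (hf.contMDiffAt_normalPart p ξ) hN
    rw [hflat _ _ _ (smoothFieldAt_extend p a) (smoothFieldAt_extend p b)
      (hf.contMDiffAt_normalPart p ξ) hN, ea, eb, hξp, haa, hab,
      show metric f p b a = -1 from (mink_comm _ _).trans hab] at h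
    norm_num at h
    exact sub_eq_zero.mp h.symm
  · intro h X Y ξ hX hY hξ hn
    rw [hcurv X Y ξ hX hY hξ hn, h (ξ p), sub_self, smul_zero]
    · rw [mink_comm]; exact hn.self_of_nhds a
    · rw [mink_comm]; exact hn.self_of_nhds b

end

end

end NullDir

/-! ### The theorem, in the null basis given by the tangent part of Z and W -/

theorem mainTheorem11 {M : Type*} [TopologicalSpace M]
    [ChartedSpace (EuclideanSpace ℝ (Fin 2)) M] [IsManifold (𝓡 2) ∞ M]
    (f : M → V4) (hf : IsTimelikeImmersion f)
    (o : ∀ p : M, Orientation ℝ (TangentSpace (𝓡 2) p) (Fin 2)) (ho : IsSurfaceOrientation o)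
    (Z : V4) (hZ : mink Z Z = 1) (hnull : HasCanonicalNullDirection f Z)
    (hII : ∀ p : M, secondFF f p (tangentPart f p Z) (tangentPart f p Z) ≠ 0)
    (W : ∀ p : M, TangentSpace (𝓡 2) p)
    (hW : ∀ p : M, W p ≠ 0 ∧ metric f p (W p) (W p) = 0 ∧
      metric f p (tangentPart f p Z) (W p) = -1) :
    ∀ p : M, IsAsymptotic f o p (tangentPart f p Z) ∧
      (IsAsymptotic f o p (W p) ↔ meanCurvature f p = 0 ∨ NormalFlatAt f p) := by
  intro p
  obtain ⟨hW0, hWW, hZW⟩ := hW p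
  obtain ⟨hZ0, hZZ⟩ := hnull p
  have hT := hf.isTimelike p
  set a : Plane := tangentPart f p Z with ha
  set b : Plane := W p with hb
  set n := normalPart f p Z with hn
  have hZn : Z = planeDiff f p a + n := by
    rw [hn, normalPart_eq, norOf, ← tangentPart_eq, ← ha]; abel
  have hnor : ∀ v u, mink (planeDiff f p u) (norOf (planeDiff f p) v) = 0 := fun v u => by
    rw [mink_comm, mink_norOf hT]
  have hnn : mink n n = 1 := by
    have h1 : mink (planeDiff f p a) n = 0 := hnor Z a
    have h2 : mink (planeDiff f p a) (planeDiff f p a) = 0 := hZZ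
    rw [hZn] at hZ
    simp only [mink_add_left, mink_add_right, mink_comm n (planeDiff f p a), h1, h2] at hZ
    linarith
  have hdet : a 0 * b 1 - a 1 * b 0 ≠ 0 := by
    intro h
    have := gram_change_basis (planeDiff f p) a b
    rw [h, show mink (planeDiff f p a) (planeDiff f p a) = 0 from hZZ,
      show mink (planeDiff f p a) (planeDiff f p b) = -1 from hZW] at this
    norm_num at this
  have hsec : ∀ (u w v : Plane), mink (planeDiff f p u) (secondFF f p w v) = 0 := fun u w v => by
    rw [hf.secondFF_eq]; exact hnor _ u
  have hsymm : secondFF f p b a = secondFF f p a b := by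
    rw [hf.secondFF_eq, hf.secondFF_eq, hf.hess_symm]
  -- Nullity controls II(u, Z^⊤) for every u; here u = W.
  have hn_ab : mink n (secondFF f p a b) = 0 := by
    rw [← hsymm]; exact hf.mink_normalPart_secondFF hnull p b
  have key := normal_plane_algebra (x := planeDiff f p a) (y := planeDiff f p b) (n := n)
    (xx := secondFF f p a a) (xy := secondFF f p a b) (yy := secondFF f p b b)
    hZZ hWW hZW (hnor Z a) (hnor Z b) hnn (hsec _ _ _) (hsec _ _ _) (hsec _ _ _) (hsec _ _ _)
    (hsec _ _ _) (hsec _ _ _) (hf.mink_normalPart_secondFF hnull p a) hn_ab (hII p)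
  have hda := hf.delta_eq_zero_iff ho (p := p) hdet a
  have hdb := hf.delta_eq_zero_iff ho (p := p) hdet b
  rw [hsymm] at hdb
  refine ⟨⟨hZ0, hda.mpr key.1⟩, ?_⟩
  have hH := hf.meanCurvature_eq hZZ hWW hZW
  rw [hf.normalFlatAt_iff hZZ hWW hZW, hH, neg_eq_zero, ← key.2, ← hdb]
  exact and_iff_right hW0
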